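/- \textbf{Conventions.} A dispace is a pair $\mathcal X=(X,dX)$ of a topological space $X$ and a set $dX$ of paths $[0,1]\to X$ (dipaths) that contains the constant paths and is closed under precomposition with continuous non-decreasing maps $[0,1]\to[0,1]$ and under concatenation. A directed subspace of $\mathcal X$ is a dispace $\mathcal A=(A,dA)$ with $A\subseteq X$ a subspace and $dA\subseteq dX$. For $x,y\in X$, the trace space $T(\mathcal X)(x,y)$ is the space of dipaths from $x$ to $y$ (compact-open topology) modulo the equivalence relation generated by reparametrization along non-decreasing continuous surjections of $[0,1]$, with the quotient topology; the trace category $P(\mathcal X)$ has the points of $X$ as objects, traces as morphisms and concatenation as composition. A natural system on a category $C$ with values in $V$ is a functor $D\colon F(C)\to V$, where $F(C)$ has the morphisms of $C$ as objects and, as morphisms $f\to f'$, the pairs $(u,v)$ with $u f v=f'$. $\mathbf{Act}$ is the category of pairs $(S,G)$ of a pointed set $S$ (with base point $0_S$) and a group $G$ acting on $S$ on the right; morphisms are pairs $(f',f'')$ of a pointed map and a group homomorphism with $f'(x\cdot g)=f'(x)\cdot f''(g)$. A morphism is null if $f'$ is constant at the base point. The kernel of $f\colon(S,G)\to(T,H)$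 is $(f'^{-1}(0_T),\,f''^{-1}(\mathrm{Fix}_H(0_T)))$ and its cokernel is $(T/R,H)$, where $R$ is the $H$-stable equivalence relation generated by $f'(x)\sim 0_T$ for all $x\in S$. A sequence $\bullet\xrightarrow{f}\bullet\xrightarrow{g}\bullet$ is exact if $\ker(\operatorname{coker} f)=\ker g$. Pointed sets are viewed in $\mathbf{Act}$ as actions of the trivial group, and a group $G$ as $(|G|,G)$ with its right action on itself, pointed at $1$. A sequence of natural systems with values in $\mathbf{Act}$ is exact if it is exact at each object of $F(C)$. For $n\ge1$, $\vec P_n(\mathcal X)\colon F(P(\mathcal X))\to\mathbf{Act}$ sends a trace $f$ from $x$ to $y$ to $\pi_{n-1}(T(\mathcal X)(x,y),f)$, with $(u,v)$ acting by $g\mapsto u\star g\star v$; its restriction to $P(\mathcal A)$ along the inclusion $P(\mathcal A)\to P(\mathcal X)$ is denoted in the same way. For $n\ge 2$, $\vec P_n(\mathcal X,\mathcal A)$ is the natural system on $P(\mathcal A)$ sending $f$ to the relative homotopy $\pi_{n-1}(T(\mathcal X)(x,y),T(\mathcal A)(x,y),f)$, a group for $n\ge3$ and a pointed set for $n=2$;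 in the sequence below, $\vec P_2(\mathcal X,\mathcal A)$ carries the right action of the group $\vec P_2(\mathcal X)$ by concatenation. Here $T(\mathcal A)(x,y)\subseteq T(\mathcal X)(x,y)$ is taken with its own topology of trace space: $\pi_m(S,B,b)$ is the set of homotopy classes of maps $I^m\to S$ that restrict to a continuous map from $\partial I^m$ into $B$ and are constant at $b$ on the closure of $\partial I^m\setminus\{x_m=0\}$, through such maps (the homotopy on $\partial I^m$ being continuous into $B$). Finally $\vec P_1(\mathcal X,\mathcal A)$ is the pointwise cokernel of $\vec P_1(\mathcal A)\to\vec P_1(\mathcal X)$. \textbf{Theorem.} Let $\mathcal X$ be a dispace and $\mathcal A$ a directed subspace of $\mathcal X$. The following sequence of natural systems of actions on $P(\mathcal A)$ is exact: \begin{align*} \cdots\to \vec P_n(\mathcal A)\to\vec P_n(\mathcal X)\to{}&\vec P_n(\mathcal X,\mathcal A)\xrightarrow{\partial_n}\vec P_{n-1}(\mathcal A)\to\cdots\\ \cdots\to\vec P_2(\mathcal A)\xrightarrow{v}\vec P_2(\mathcal X)\xrightarrow{f}(\vec P_2(\mathcal X,\mathcal A),\vec P_2(\mathcal X))&\xrightarrow{g}\vec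 P_1(\mathcal A)\xrightarrow{h}\vec P_1(\mathcal X)\to\vec P_1(\mathcal X,\mathcal A)\to0 . \end{align*} The morphisms $\vec P_n(\mathcal A)\to\vec P_n(\mathcal X)$ and, for $n\ge3$, $\vec P_n(\mathcal X)\to\vec P_n(\mathcal X,\mathcal A)$ are induced by inclusions; $\partial_n$ is restriction to the face $x_{n-1}=0$; $f(\sigma)=(0\cdot\sigma,\sigma)$, where $0$ is the base point of $\vec P_2(\mathcal X,\mathcal A)$; $g$ sends the class of a path $\tau$ to the path component of $\tau(0)$, and is trivial on the groups; and $\vec P_1(\mathcal X)\to\vec P_1(\mathcal X,\mathcal A)$ is the projection onto the cokernel. -/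

import Mathlib

open CategoryTheory
open scoped unitInterval Topology Topology.Homotopy

universe u

namespace Dihom

noncomputable section

/-! ### The category of actions -/

/-- An object of `Act`: a pointed set with a right action of a group. The base point need not be
fixed by the action. -/
structure Act : Type (u + 1) where
  pts : Type u
  base : pts
  grp : Type u
  [group : Group grp]
  act : pts → grp → pts
  act_one : ∀ x, act x 1 = x
  act_mul : ∀ x g h, act x (g * h) = act (act x g) h

attribute [instance] Act.group

namespace Act

/-- A morphism of actions: a pointed map and a group homomorphism, compatible with the actions. -/
@[ext]
structure Hom (X Y : Act.{u}) : Type u where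
  onPts : X.pts → Y.pts
  onGrp : X.grp →* Y.grp
  map_base : onPts X.base = Y.base
  map_act : ∀ x g, onPts (X.act x g) = Y.act (onPts x) (onGrp g)

instance : Category Act.{u} where
  Hom := Hom
  id X := ⟨id, MonoidHom.id _, rfl, fun _ _ => rfl⟩
  comp f g := ⟨g.onPts ∘ f.onPts, g.onGrp.comp f.onGrp,
    by simp [f.map_base, g.map_base], fun x h => by simp [f.map_act, g.map_act]⟩

@[simp] theorem id_onPts (X : Act.{u}) (x : X.pts) : Hom.onPts (𝟙 X) x = x := rfl
@[simp] theorem id_onGrp (X : Act.{u}) (x : X.grp) : Hom.onGrp (𝟙 X) x = x := rfl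
@[simp] theorem comp_onPts {X Y Z : Act.{u}} (f : X ⟶ Y) (g : Y ⟶ Z) (x : X.pts) :
    Hom.onPts (f ≫ g) x = g.onPts (f.onPts x) := rfl
@[simp] theorem comp_onGrp {X Y Z : Act.{u}} (f : X ⟶ Y) (g : Y ⟶ Z) (x : X.grp) :
    Hom.onGrp (f ≫ g) x = g.onGrp (f.onGrp x) := rfl

theorem hom_ext {X Y : Act.{u}} {f g : X ⟶ Y} (h : ∀ x, f.onPts x = g.onPts x)
    (h' : ∀ x, f.onGrp x = g.onGrp x) : f = g :=
  Hom.ext (funext h) (MonoidHom.ext h')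

/-- The subgroup fixing the base point. -/
def fix (X : Act.{u}) : Subgroup X.grp where
  carrier := {g | X.act X.base g = X.base}
  one_mem' := X.act_one _
  mul_mem' {g h} hg hh := by
    have hg' : X.act X.base g = X.base := hg
    have hh' : X.act X.base h = X.base := hh
    change X.act X.base (g * h) = X.base
    rw [X.act_mul, hg', hh']
  inv_mem' {g} hg := by
    have hg' : X.act X.base g = X.base := hg
    change X.act X.base g⁻¹ = X.base
    conv_lhs => rw [← hg']
    rw [← X.act_mul, mul_inv_cancel, X.act_one]

/-- Null morphisms: those whose map of pointed sets is constant at the base point. -/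
def IsNull {X Y : Act.{u}} (f : X ⟶ Y) : Prop := ∀ x, f.onPts x = Y.base

/-- The underlying set of the kernel. -/
def kerSet {X Y : Act.{u}} (f : X ⟶ Y) : Set X.pts := {x | f.onPts x = Y.base}

/-- The group of the kernel: the preimage of the subgroup fixing the base point. -/
def kerGrp {X Y : Act.{u}} (f : X ⟶ Y) : Subgroup X.grp := Y.fix.comap f.onGrp

theorem act_mem_kerSet {X Y : Act.{u}} (f : X ⟶ Y) {x : X.pts} (hx : x ∈ kerSet f) {g : X.grp}
    (hg : g ∈ kerGrp f) : X.act x g ∈ kerSet f := by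
  have hx' : f.onPts x = Y.base := hx
  change f.onPts (X.act x g) = Y.base
  rw [f.map_act, hx']
  exact hg

/-- The kernel of a morphism of actions. -/
def ker {X Y : Act.{u}} (f : X ⟶ Y) : Act.{u} where
  pts := kerSet f
  base := ⟨X.base, f.map_base⟩
  grp := kerGrp f
  act x g := ⟨X.act x g, act_mem_kerSet f x.2 g.2⟩
  act_one x := Subtype.ext (X.act_one x)
  act_mul x g h := Subtype.ext (X.act_mul x g h)

/-- The inclusion of the kernel. -/
def kerι {X Y : Act.{u}} (f : X ⟶ Y) : ker f ⟶ X where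
  onPts := Subtype.val
  onGrp := (kerGrp f).subtype
  map_base := rfl
  map_act _ _ := rfl

/-- `kerι f` is the kernel of `f` with respect to the null morphisms. -/
theorem ker_universal {X Y : Act.{u}} (f : X ⟶ Y) :
    IsNull (kerι f ≫ f) ∧
      ∀ {Z : Act.{u}} (g : Z ⟶ X), IsNull (g ≫ f) → ∃! g' : Z ⟶ ker f, g' ≫ kerι f = g := by
  refine ⟨fun x => x.2, fun {Z} g hg => ?_⟩
  have hG : ∀ h, g.onGrp h ∈ kerGrp f := fun h => by
    change Y.act Y.base (f.onGrp (g.onGrp h)) = Y.base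
    have h1 : f.onPts (g.onPts (Z.act Z.base h)) = Y.base := hg _
    rwa [g.map_act, f.map_act, g.map_base, f.map_base] at h1
  refine ⟨⟨fun z => ⟨g.onPts z, hg z⟩, g.onGrp.codRestrict _ hG, Subtype.ext g.map_base,
    fun x h => Subtype.ext (g.map_act x h)⟩, hom_ext (fun _ => rfl) (fun _ => rfl), ?_⟩
  rintro g' rfl
  exact hom_ext (fun _ => rfl) (fun _ => rfl)

/-- The relation generating the congruence by which the cokernel is formed: each point of the image
of `f` is identified with the base point, and so are their translates under the action. -/
def cokerRel {X Y : Act.{u}} (f : X ⟶ Y) (y y' : Y.pts) : Prop :=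
  ∃ x h, y = Y.act (f.onPts x) h ∧ y' = Y.act Y.base h

/-- The cokernel of a morphism of actions: the quotient of the set by the congruence that
identifies the image with the base point, with the same group. -/
def coker {X Y : Act.{u}} (f : X ⟶ Y) : Act.{u} where
  pts := Quot (cokerRel f)
  base := Quot.mk _ Y.base
  grp := Y.grp
  act y g := Quot.map (fun y => Y.act y g) (by
    rintro _ _ ⟨x, h, rfl, rfl⟩
    exact ⟨x, h * g, (Y.act_mul _ _ _).symm, (Y.act_mul _ _ _).symm⟩) y
  act_one := by rintro ⟨y⟩; exact congrArg (Quot.mk _) (Y.act_one y)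
  act_mul := by rintro ⟨y⟩ g h; exact congrArg (Quot.mk _) (Y.act_mul y g h)

/-- The projection onto the cokernel. -/
def cokerπ {X Y : Act.{u}} (f : X ⟶ Y) : Y ⟶ coker f where
  onPts := Quot.mk _
  onGrp := MonoidHom.id _
  map_base := rfl
  map_act _ _ := rfl

/-- `cokerπ f` is the cokernel of `f` with respect to the null morphisms. -/
theorem coker_universal {X Y : Act.{u}} (f : X ⟶ Y) :
    IsNull (f ≫ cokerπ f) ∧
      ∀ {Z : Act.{u}} (g : Y ⟶ Z), IsNull (f ≫ g) → ∃! g' : coker f ⟶ Z, cokerπ f ≫ g' = g := by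
  refine ⟨fun x => Quot.sound ⟨x, 1, (Y.act_one _).symm, (Y.act_one _).symm⟩, fun {Z} g hg => ?_⟩
  refine ⟨⟨Quot.lift g.onPts ?_, g.onGrp, g.map_base, ?_⟩,
    hom_ext (fun _ => rfl) (fun _ => rfl), ?_⟩
  · rintro _ _ ⟨x, h, rfl, rfl⟩
    rw [g.map_act, g.map_act, g.map_base]
    exact congrArg (fun z => Z.act z _) (hg x)
  · rintro ⟨y⟩ h
    exact g.map_act y h
  · rintro g' rfl
    refine hom_ext ?_ (fun _ => rfl)
    rintro ⟨y⟩
    rfl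

/-- The morphism induced on cokernels by a commutative square. -/
def cokerMap {X Y X' Y' : Act.{u}} {f : X ⟶ Y} {f' : X' ⟶ Y'} (a : X ⟶ X') (b : Y ⟶ Y')
    (w : f ≫ b = a ≫ f') : coker f ⟶ coker f' where
  onPts := Quot.map b.onPts (by
    rintro _ _ ⟨x, h, rfl, rfl⟩
    refine ⟨a.onPts x, b.onGrp h, ?_, ?_⟩
    · rw [b.map_act]
      exact congrArg (fun z => Y'.act z _) (congrArg (fun k : X ⟶ Y' => k.onPts x) w)
    · rw [b.map_act, b.map_base])
  onGrp := b.onGrp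
  map_base := congrArg (Quot.mk _) b.map_base
  map_act := by rintro ⟨y⟩ g; exact congrArg (Quot.mk _) (b.map_act y g)

/-- A sequence `X ⟶ Y ⟶ Z` of actions is exact at `Y` if the kernel of the cokernel of the first
morphism and the kernel of the second one are the same subobject of `Y`. -/
def Exact {X Y Z : Act.{u}} (f : X ⟶ Y) (g : Y ⟶ Z) : Prop :=
  kerSet (cokerπ f) = kerSet g ∧ kerGrp (cokerπ f) = kerGrp g

/-- The embedding of pointed sets: the action of the trivial group. -/
def ofPointed (S : Type u) (s : S) : Act.{u} where
  pts := S
  base := s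
  grp := PUnit
  act x _ := x
  act_one _ := rfl
  act_mul _ _ _ := rfl

/-- The morphism of trivial-group actions induced by a pointed map. -/
def ofPointedMap {S T : Type u} {s : S} {t : T} (f : S → T) (h : f s = t) :
    ofPointed S s ⟶ ofPointed T t where
  onPts := f
  onGrp := 1
  map_base := h
  map_act _ _ := rfl

/-- The embedding of groups: the right action of a group on its underlying set, pointed at `1`. -/
def ofGroup (G : Type u) [Group G] : Act.{u} where
  pts := G
  base := 1
  grp := G
  act x g := x * g
  act_one := mul_one
  act_mul x g h := (mul_assoc x g h).symm

/-- The morphism of actions induced by a group homomorphism. -/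
def ofGroupMap {G H : Type u} [Group G] [Group H] (f : G →* H) : ofGroup G ⟶ ofGroup H where
  onPts := f
  onGrp := f
  map_base := f.map_one
  map_act := f.map_mul

/-- The zero object: the trivial group acting on a singleton. -/
def zero : Act.{u} := ofPointed PUnit PUnit.unit

/-- The morphism to the zero object. -/
def toZero (X : Act.{u}) : X ⟶ zero where
  onPts _ := PUnit.unit
  onGrp := 1
  map_base := rfl
  map_act _ _ := rfl

end Act

/-! ### Natural systems -/

/-- The category of factorizations of `C`: its objects are the morphisms of `C`. -/
structure Factn (C : Type*) [Category C] where
  {src : C}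
  {tgt : C}
  arr : src ⟶ tgt

namespace Factn

variable {C : Type*} [Category C]

/-- A morphism from `f` to `f'` is a pair `(left, right)` with `left ≫ f ≫ right = f'`. -/
@[ext]
structure Hom (f f' : Factn C) where
  left : f'.src ⟶ f.src
  right : f.tgt ⟶ f'.tgt
  w : left ≫ f.arr ≫ right = f'.arr

instance : Category (Factn C) where
  Hom := Hom
  id f := ⟨𝟙 _, 𝟙 _, by simp⟩
  comp a b := ⟨b.left ≫ a.left, a.right ≫ b.right, by
    have ha := a.w
    have hb := b.w
    rw [← hb, ← ha]
    simp only [Category.assoc]⟩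
  id_comp a := by apply Hom.ext <;> simp
  comp_id a := by apply Hom.ext <;> simp
  assoc a b c := by apply Hom.ext <;> simp

/-- The functor induced on categories of factorizations. -/
def map {D : Type*} [Category D] (F : C ⥤ D) : Factn C ⥤ Factn D where
  obj f := ⟨F.map f.arr⟩
  map a := ⟨F.map a.left, F.map a.right, by rw [← F.map_comp, ← F.map_comp, a.w]⟩
  map_id f := by
    apply Hom.ext
    · exact F.map_id _
    · exact F.map_id _
  map_comp a b := by
    apply Hom.ext
    · exact F.map_comp _ _
    · exact F.map_comp _ _

end Factn

/-- Natural systems on `C` with values in `V`; their morphisms are natural transformations. -/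
abbrev NatSys (C : Type*) [Category C] (V : Type*) [Category V] := Factn C ⥤ V

/-- A sequence of natural systems of actions is exact when it is exact at every morphism of `C`. -/
def NatExact {C : Type*} [Category C] {D E F : NatSys C Act.{u}} (a : D ⟶ E) (b : E ⟶ F) : Prop :=
  ∀ f : Factn C, Act.Exact (a.app f) (b.app f)

/-! ### Homotopy groups of pointed spaces, with values in actions -/

/-- Pointed topological spaces. -/
structure PTop : Type (u + 1) where
  carrier : Type u
  [top : TopologicalSpace carrier]
  pt : carrier

attribute [instance] PTop.top

namespace PTop

/-- Pointed continuous maps. -/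
@[ext]
structure Hom (S T : PTop.{u}) : Type u where
  map : C(S.carrier, T.carrier)
  map_pt : map S.pt = T.pt

instance : Category PTop.{u} where
  Hom := Hom
  id S := ⟨ContinuousMap.id _, rfl⟩
  comp f g := ⟨g.map.comp f.map, by simp [f.map_pt, g.map_pt]⟩

end PTop

/-- The map on generalized loops induced by a continuous map. -/
def genLoopMap {N S T : Type*} [TopologicalSpace S] [TopologicalSpace T] {s : S} {t : T}
    (f : C(S, T)) (h : f s = t) (p : Ω^ N S s) : Ω^ N T t :=
  ⟨f.comp p.1, fun y hy => (congrArg f (p.2 y hy)).trans h⟩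

theorem genLoopMap_homotopic {N S T : Type*} [TopologicalSpace S] [TopologicalSpace T] {s : S}
    {t : T} (f : C(S, T)) (h : f s = t) {p q : Ω^ N S s} (H : GenLoop.Homotopic p q) :
    GenLoop.Homotopic (genLoopMap f h p) (genLoopMap f h q) :=
  ContinuousMap.HomotopicRel.comp_continuousMap H f

theorem genLoopMap_transAt {N S T : Type*} [DecidableEq N] [TopologicalSpace S]
    [TopologicalSpace T] {s : S} {t : T} (f : C(S, T)) (h : f s = t) (i : N) (p q : Ω^ N S s) :
    genLoopMap f h (GenLoop.transAt i p q) =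
      GenLoop.transAt i (genLoopMap f h p) (genLoopMap f h q) := by
  apply GenLoop.ext
  intro y
  change f (GenLoop.transAt i p q y) = _
  simp only [GenLoop.transAt, GenLoop.coe_copy]
  split_ifs <;> rfl

/-- The homotopy group `π_{n+1}(S, s)`, with the product `[p] * [q]` given by the concatenation
of `p` followed by `q`. (Mathlib's product on `HomotopyGroup` is `q` followed by `p`.) -/
abbrev PiGrp (n : ℕ) (S : Type u) [TopologicalSpace S] (s : S) : Type u :=
  (HomotopyGroup.Pi (n + 1) S s)ᵐᵒᵖ

/-- The class in `π_{n+1}(S, s)` of a map of the cube. -/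
def PiGrp.mk {n : ℕ} {S : Type u} [TopologicalSpace S] {s : S} (p : Ω^ (Fin (n + 1)) S s) :
    PiGrp n S s :=
  MulOpposite.op (Quotient.mk (GenLoop.Homotopic.setoid (Fin (n + 1)) s) p)

theorem PiGrp.ind {n : ℕ} {S : Type u} [TopologicalSpace S] {s : S}
    {P : PiGrp n S s → Prop} (h : ∀ p, P (PiGrp.mk p)) (a : PiGrp n S s) : P a := by
  obtain ⟨a⟩ := a
  induction a using Quotient.inductionOn with
  | h p => exact h p

theorem PiGrp.sound {n : ℕ} {S : Type u} [TopologicalSpace S] {s : S}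
    {p q : Ω^ (Fin (n + 1)) S s} (h : GenLoop.Homotopic p q) : PiGrp.mk p = PiGrp.mk q :=
  congrArg MulOpposite.op (Quotient.sound h)

theorem PiGrp.mk_mul {n : ℕ} {S : Type u} [TopologicalSpace S] {s : S} (i : Fin (n + 1))
    (p q : Ω^ (Fin (n + 1)) S s) :
    PiGrp.mk p * PiGrp.mk q = PiGrp.mk (GenLoop.transAt i p q) :=
  congrArg MulOpposite.op (HomotopyGroup.mul_spec (i := i) (p := q) (q := p))

theorem PiGrp.mk_const {n : ℕ} {S : Type u} [TopologicalSpace S] {s : S} :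
    PiGrp.mk (GenLoop.const : Ω^ (Fin (n + 1)) S s) = 1 := rfl

/-- The homomorphism induced on homotopy groups by a pointed map. -/
def PiGrp.map (n : ℕ) {S T : Type u} [TopologicalSpace S] [TopologicalSpace T] {s : S} {t : T}
    (f : C(S, T)) (h : f s = t) : PiGrp n S s →* PiGrp n T t :=
  MonoidHom.mk'
    (fun a => MulOpposite.op (Quotient.map (genLoopMap f h)
      (fun _ _ H => genLoopMap_homotopic f h H) a.unop))
    (by
      intro a b
      induction a using PiGrp.ind with
      | h p =>
      induction b using PiGrp.ind with
      | h q =>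
      rw [PiGrp.mk_mul 0]
      change PiGrp.mk (genLoopMap f h _) = PiGrp.mk (genLoopMap f h p) * PiGrp.mk (genLoopMap f h q)
      rw [PiGrp.mk_mul 0, genLoopMap_transAt])

@[simp]
theorem PiGrp.map_mk (n : ℕ) {S T : Type u} [TopologicalSpace S] [TopologicalSpace T] {s : S}
    {t : T} (f : C(S, T)) (h : f s = t) (p : Ω^ (Fin (n + 1)) S s) :
    PiGrp.map n f h (PiGrp.mk p) = PiGrp.mk (genLoopMap f h p) := rfl

/-- The map induced on path components by a continuous map. -/
def pi0Map {S T : Type*} [TopologicalSpace S] [TopologicalSpace T] (f : C(S, T)) :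
    ZerothHomotopy S → ZerothHomotopy T :=
  ZerothHomotopy.lift (fun x => ZerothHomotopy.mk (f x))
    (fun _ _ p => ZerothHomotopy.sound (p.map f.continuous))

/-- The functor `π_0` with values in actions (of the trivial group). -/
def pi0Act : PTop.{u} ⥤ Act.{u} where
  obj S := Act.ofPointed (ZerothHomotopy S.carrier) (ZerothHomotopy.mk S.pt)
  map f := Act.ofPointedMap (pi0Map f.map) (congrArg ZerothHomotopy.mk f.map_pt)
  map_id _ := Act.hom_ext (by rintro ⟨x⟩; rfl) (fun _ => rfl)
  map_comp _ _ := Act.hom_ext (by rintro ⟨x⟩; rfl) (fun _ => rfl)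

/-- The functor `π_{n+1}` with values in actions (of groups on themselves). -/
def piGrpAct (n : ℕ) : PTop.{u} ⥤ Act.{u} where
  obj S := Act.ofGroup (PiGrp n S.carrier S.pt)
  map f := Act.ofGroupMap (PiGrp.map n f.map f.map_pt)
  map_id _ := Act.hom_ext (PiGrp.ind fun _ => rfl) (PiGrp.ind fun _ => rfl)
  map_comp _ _ := Act.hom_ext (PiGrp.ind fun _ => rfl) (PiGrp.ind fun _ => rfl)

/-- The functor `π_n` with values in actions. -/
def piAct : ℕ → (PTop.{u} ⥤ Act.{u})
  | 0 => pi0Act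
  | n + 1 => piGrpAct n

/-! ### Relative homotopy of pointed pairs -/

/-- Pointed pairs `(S, B)`: a space `S`, a subset `B` of `S` given as a space with a continuous
injection into `S`, and a base point in `B`. The topology of `B` is its own: it is allowed to be
finer than the subspace topology. -/
structure PPair : Type (u + 1) where
  space : Type u
  [topSpace : TopologicalSpace space]
  sub : Type u
  [topSub : TopologicalSpace sub]
  incl : C(sub, space)
  incl_injective : Function.Injective incl
  pt : sub

attribute [instance] PPair.topSpace PPair.topSub

namespace PPair

/-- Morphisms of pointed pairs: continuous maps that restrict to continuous pointed maps of the
subspaces. -/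
@[ext]
structure Hom (P Q : PPair.{u}) : Type u where
  onSpace : C(P.space, Q.space)
  onSub : C(P.sub, Q.sub)
  w : ∀ b, onSpace (P.incl b) = Q.incl (onSub b)
  map_pt : onSub P.pt = Q.pt

instance : Category PPair.{u} where
  Hom := Hom
  id P := ⟨ContinuousMap.id _, ContinuousMap.id _, fun _ => rfl, rfl⟩
  comp f g := ⟨g.onSpace.comp f.onSpace, g.onSub.comp f.onSub,
    fun b => by simp [f.w, g.w], by simp [f.map_pt, g.map_pt]⟩

/-- The pointed subspace of a pair. -/
def toSub : PPair.{u} ⥤ PTop.{u} where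
  obj P := ⟨P.sub, P.pt⟩
  map f := ⟨f.onSub, f.map_pt⟩

/-- The pointed ambient space of a pair. -/
def toSpace : PPair.{u} ⥤ PTop.{u} where
  obj P := ⟨P.space, P.incl P.pt⟩
  map f := ⟨f.onSpace, by rw [f.w, f.map_pt]⟩

/-- The inclusion of the pointed subspace into the ambient space. -/
def inclNat : toSub.{u} ⟶ toSpace.{u} where
  app P := ⟨P.incl, rfl⟩
  naturality _ _ f := PTop.Hom.ext (ContinuousMap.ext fun b => (f.w b).symm)

end PPair

/-- The union of the faces of the cube `I^{n+1}` other than the face `x_{n+1} = 0`. -/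
def cubeJ (n : ℕ) : Set (Fin (n + 1) → I) :=
  {y | y (Fin.last n) = 1 ∨ ∃ i : Fin n, y i.castSucc = 0 ∨ y i.castSucc = 1}

/-- `cubeJ n` is the closure of the complement of the distinguished face in the boundary. -/
theorem closure_boundary_diff_face (n : ℕ) :
    closure (Cube.boundary (Fin (n + 1)) \ {y | y (Fin.last n) = 0}) = cubeJ n := by
  apply subset_antisymm
  · refine closure_minimal ?_ ?_
    · rintro y ⟨⟨i, hi⟩, h0⟩
      induction i using Fin.lastCases with
      | last => exact Or.inl (hi.resolve_left h0)
      | cast i => exact Or.inr ⟨i, hi⟩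
    · have : cubeJ n = {y | y (Fin.last n) = 1} ∪
          ⋃ i : Fin n, ({y | y i.castSucc = 0} ∪ {y | y i.castSucc = 1}) := by
        ext y; simp [cubeJ]
      rw [this]
      exact (isClosed_eq (by fun_prop) (by fun_prop)).union (isClosed_iUnion_of_finite fun i =>
        (isClosed_eq (by fun_prop) (by fun_prop)).union (isClosed_eq (by fun_prop) (by fun_prop)))
  · rintro y (h | ⟨i, h⟩)
    · exact subset_closure ⟨⟨_, Or.inr h⟩, by simp [h]⟩
    · by_cases hy : y (Fin.last n) = 0
      · let F : ℝ → (Fin (n+1) → I) := fun s => 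
          Function.update y (Fin.last n) (Set.projIcc 0 1 zero_le_one s)
        have hF : Continuous F := by fun_prop
        have h0 : F 0 = y := by
          simp only [F, Set.projIcc_left]
          refine (congrArg (Function.update y (Fin.last n)) hy.symm).trans ?_
          exact Function.update_eq_self (Fin.last n) y
        have : y ∈ closure (F '' Set.Ioi 0) := by
          rw [← h0]
          exact image_closure_subset_closure_image hF
            ⟨0, by rw [closure_Ioi]; exact Set.self_mem_Ici, rfl⟩
        refine closure_mono ?_ this
        rintro _ ⟨s, hs, rfl⟩
        refine ⟨⟨i.castSucc, ?_⟩, ?_⟩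
        · simpa [F, Function.update_of_ne (Fin.castSucc_lt_last i).ne] using h
        · simp only [F, Set.mem_ofPred_eq, Function.update_self]
          intro h'
          have := (Set.projIcc_eq_left (zero_lt_one)).1 h'
          exact absurd this (not_le.2 hs)
      · exact subset_closure ⟨⟨_, h⟩, hy⟩

/-- The inclusion of `I^n` into `I^{n+1} = I^n × I`, with given last coordinate. -/
def cubeSnoc {n : ℕ} (t : Fin n → I) (s : I) : Fin (n + 1) → I :=
  Fin.snoc (α := fun _ => I) t s

/-- Maps `(I^{n+1}, ∂I^{n+1}, J) → (S, B, pt)`. As `∂I^{n+1}` is the union of `J` and of the face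
`x_{n+1} = 0`, such a map is given by a continuous map `I^{n+1} → S` constant at the base point
on `J`, whose restriction to the face `x_{n+1} = 0` is a continuous map `I^n → B`, constant at the
base point on `∂I^n`. -/
@[ext]
structure RelLoop (P : PPair.{u}) (n : ℕ) : Type u where
  toMap : C(Fin (n + 1) → I, P.space)
  face : Ω^ (Fin n) P.sub P.pt
  toMap_face : ∀ t, toMap (cubeSnoc t 0) = P.incl (face t)
  toMap_J : ∀ y ∈ cubeJ n, toMap y = P.incl P.pt

namespace RelLoop

variable {P Q R : PPair.{u}} {n : ℕ}

/-- Homotopies through maps of triples. -/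
def Homotopic (p q : RelLoop P n) : Prop :=
  ∃ H : I → RelLoop P n,
    Continuous (fun z : I × (Fin (n + 1) → I) => (H z.1).toMap z.2) ∧
    Continuous (fun z : I × (Fin n → I) => (H z.1).face z.2) ∧ H 0 = p ∧ H 1 = q

/-- The constant map. -/
def const : RelLoop P n where
  toMap := ContinuousMap.const _ (P.incl P.pt)
  face := GenLoop.const
  toMap_face _ := rfl
  toMap_J _ _ := rfl

/-- Composition with a morphism of pairs. -/
def map (f : P ⟶ Q) (p : RelLoop P n) : RelLoop Q n where
  toMap := f.onSpace.comp p.toMap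
  face := genLoopMap f.onSub f.map_pt p.face
  toMap_face t := by
    change f.onSpace (p.toMap _) = Q.incl (f.onSub (p.face t))
    rw [p.toMap_face, f.w]
  toMap_J y hy := by
    change f.onSpace (p.toMap _) = _
    rw [p.toMap_J y hy, f.w, f.map_pt]

theorem Homotopic.map (f : P ⟶ Q) {p q : RelLoop P n} (h : Homotopic p q) :
    Homotopic (map f p) (map f q) := by
  obtain ⟨H, h1, h2, h3, h4⟩ := h
  exact ⟨fun s => RelLoop.map f (H s), f.onSpace.continuous.comp h1, f.onSub.continuous.comp h2,
    congrArg _ h3, congrArg _ h4⟩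

/-- A map of the cube sending the whole boundary to the base point. -/
def ofGenLoop (p : Ω^ (Fin (n + 1)) P.space (P.incl P.pt)) : RelLoop P n where
  toMap := p.1
  face := GenLoop.const
  toMap_face t := p.2 _ ⟨Fin.last n, Or.inl (Fin.snoc_last _ _)⟩
  toMap_J y hy := p.2 y (by
    rcases hy with h | ⟨i, h⟩
    · exact ⟨_, Or.inr h⟩
    · exact ⟨_, h⟩)

theorem ofGenLoop_homotopic {p q : Ω^ (Fin (n + 1)) P.space (P.incl P.pt)}
    (h : GenLoop.Homotopic p q) : Homotopic (ofGenLoop (P := P) p) (ofGenLoop q) := by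
  obtain ⟨H⟩ := h
  refine ⟨fun s => ofGenLoop ⟨⟨fun y => H (s, y), by fun_prop⟩, fun y hy => ?_⟩, ?_, ?_, ?_, ?_⟩
  · exact (H.eq_fst s hy).trans (p.2 y hy)
  · exact H.continuous
  · exact continuous_const
  · apply RelLoop.ext
    · ext y; exact H.apply_zero y
    · rfl
  · apply RelLoop.ext
    · ext y; exact H.apply_one y
    · rfl

/-! The set of such maps is identified with `n`-dimensional loops in the space of paths from `B` to
the base point. This is only used to see that homotopy is an equivalence relation and that
concatenation along the first coordinate is a group law on homotopy classes. -/

/-- The space of paths in `S` from a point of `B` to the base point. -/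
abbrev PathsTo (P : PPair.{u}) : Type u :=
  {z : C(I, P.space) × P.sub // z.1 0 = P.incl z.2 ∧ z.1 1 = P.incl P.pt}

/-- The constant path. -/
def PathsTo.base (P : PPair.{u}) : PathsTo P :=
  ⟨(ContinuousMap.const _ (P.incl P.pt), P.pt), rfl, rfl⟩

theorem continuous_cubeSnoc : Continuous (fun z : (Fin n → I) × I => cubeSnoc z.1 z.2) := by
  refine continuous_pi fun i => ?_
  induction i using Fin.lastCases with
  | last => simp only [cubeSnoc, Fin.snoc_last]; fun_prop
  | cast i => simp only [cubeSnoc, Fin.snoc_castSucc]; fun_prop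

theorem cubeSnoc_init (y : Fin (n + 1) → I) :
    cubeSnoc (fun i : Fin n => y i.castSucc) (y (Fin.last n)) = y :=
  Fin.snoc_init_self y

theorem cubeSnoc_mem_J {t : Fin n → I} (ht : t ∈ Cube.boundary (Fin n)) (s : I) :
    cubeSnoc t s ∈ cubeJ n := by
  obtain ⟨i, hi⟩ := ht
  exact Or.inr ⟨i, by simpa only [cubeSnoc, Fin.snoc_castSucc] using hi⟩

/-- Currying the last coordinate. -/
def toLoop (p : RelLoop P n) : Ω^ (Fin n) (PathsTo P) (PathsTo.base P) :=
  ⟨⟨fun t => ⟨(⟨fun s => p.toMap (cubeSnoc t s),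
        p.toMap.continuous.comp (continuous_cubeSnoc.comp
          (by fun_prop : Continuous fun s : I => (t, s)))⟩, p.face t),
      p.toMap_face t, p.toMap_J _ (Or.inl (Fin.snoc_last _ _))⟩, by
    refine Continuous.subtype_mk (Continuous.prodMk ?_ p.face.1.continuous) _
    exact ContinuousMap.continuous_of_continuous_uncurry _
      (p.toMap.continuous.comp continuous_cubeSnoc)⟩, by
    intro t ht
    apply Subtype.ext
    apply Prod.ext
    · ext s
      exact p.toMap_J _ (cubeSnoc_mem_J ht s)
    · exact p.face.2 t ht⟩

/-- Uncurrying the last coordinate. -/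
def ofLoop (p : Ω^ (Fin n) (PathsTo P) (PathsTo.base P)) : RelLoop P n where
  toMap := ⟨fun y => (p.1 (fun i => y i.castSucc)).1.1 (y (Fin.last n)), by
    have : Continuous fun y : Fin (n + 1) → I => (p.1 (fun i => y i.castSucc)).1.1 := by fun_prop
    fun_prop⟩
  face := ⟨⟨fun t => (p.1 t).1.2, by fun_prop⟩, fun t ht => by
    change (p.1 t).1.2 = P.pt
    rw [p.2 t ht]; rfl⟩
  toMap_face t := by
    change (p.1 (fun i => cubeSnoc t 0 i.castSucc)).1.1 (cubeSnoc t 0 (Fin.last n)) = _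
    simp only [cubeSnoc, Fin.snoc_last, Fin.snoc_castSucc]
    exact (p.1 t).2.1
  toMap_J y hy := by
    change (p.1 (fun i => y i.castSucc)).1.1 (y (Fin.last n)) = _
    rcases hy with h | ⟨i, h⟩
    · rw [h]; exact (p.1 _).2.2
    · rw [p.2 _ ⟨i, h⟩]; rfl

theorem ofLoop_toLoop (p : RelLoop P n) : ofLoop (toLoop p) = p := by
  apply RelLoop.ext
  · ext y
    exact congrArg p.toMap (cubeSnoc_init y)
  · rfl

theorem toLoop_ofLoop (p : Ω^ (Fin n) (PathsTo P) (PathsTo.base P)) : toLoop (ofLoop p) = p := by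
  apply GenLoop.ext
  intro t
  apply Subtype.ext
  apply Prod.ext
  · ext s
    change (p.1 (fun i => cubeSnoc t s i.castSucc)).1.1 (cubeSnoc t s (Fin.last n)) = _
    simp only [cubeSnoc, Fin.snoc_last, Fin.snoc_castSucc]
    rfl
  · rfl

theorem homotopic_iff (p q : RelLoop P n) :
    Homotopic p q ↔ GenLoop.Homotopic (toLoop p) (toLoop q) := by
  constructor
  · rintro ⟨H, h1, h2, rfl, rfl⟩
    refine ⟨⟨⟨⟨fun z => toLoop (H z.1) z.2, ?_⟩, fun _ => rfl, fun _ => rfl⟩, ?_⟩⟩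
    · refine Continuous.subtype_mk (Continuous.prodMk ?_ h2) _
      refine ContinuousMap.continuous_of_continuous_uncurry _ ?_
      exact h1.comp (Continuous.prodMk (by fun_prop)
        (continuous_cubeSnoc.comp (by fun_prop : Continuous
          fun w : (I × (Fin n → I)) × I => (w.1.2, w.2))))
    · intro s t ht
      exact ((toLoop (H s)).2 t ht).trans ((toLoop (H 0)).2 t ht).symm
  · rintro ⟨H⟩
    refine ⟨fun s => ofLoop ⟨⟨fun t => H (s, t), by fun_prop⟩, fun t ht => ?_⟩, ?_, ?_, ?_, ?_⟩
    · exact (H.eq_fst s ht).trans ((toLoop p).2 t ht)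
    · change Continuous fun z : I × (Fin (n + 1) → I) =>
        (H (z.1, fun i => z.2 i.castSucc)).1.1 (z.2 (Fin.last n))
      have : Continuous fun z : I × (Fin (n + 1) → I) =>
        (H (z.1, fun i => z.2 i.castSucc)).1.1 := by fun_prop
      fun_prop
    · exact (continuous_snd.comp continuous_subtype_val).comp H.continuous
    · conv_rhs => rw [← ofLoop_toLoop p]
      refine congrArg ofLoop ?_
      apply GenLoop.ext
      intro t
      exact H.apply_zero t
    · conv_rhs => rw [← ofLoop_toLoop q]
      refine congrArg ofLoop ?_
      apply GenLoop.ext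
      intro t
      exact H.apply_one t

/-- The homotopy relation on maps of triples. -/
def setoid (P : PPair.{u}) (n : ℕ) : Setoid (RelLoop P n) where
  r := Homotopic
  iseqv :=
    { refl := fun p => (homotopic_iff p p).2 (GenLoop.Homotopic.refl _)
      symm := fun h => (homotopic_iff _ _).2 ((homotopic_iff _ _).1 h).symm
      trans := fun h k => (homotopic_iff _ _).2
        (((homotopic_iff _ _).1 h).trans ((homotopic_iff _ _).1 k)) }

end RelLoop

/-- The relative homotopy set `π_{n+1}(S, B)`. -/
def RelPi (P : PPair.{u}) (n : ℕ) : Type u := Quotient (RelLoop.setoid P n)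

namespace RelPi

variable {P Q : PPair.{u}} {n : ℕ}

/-- The class of a map of triples. -/
def mk (p : RelLoop P n) : RelPi P n := Quotient.mk (RelLoop.setoid P n) p

theorem ind {M : RelPi P n → Prop} (h : ∀ p, M (mk p)) (a : RelPi P n) : M a :=
  Quotient.inductionOn a h

theorem sound {p q : RelLoop P n} (h : RelLoop.Homotopic p q) : mk p = mk q := Quotient.sound h

/-- Currying, on homotopy classes. -/
def equivPiGrp (P : PPair.{u}) (n : ℕ) :
    RelPi P (n + 1) ≃ PiGrp n (RelLoop.PathsTo P) (RelLoop.PathsTo.base P) :=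
  (Quotient.congr
    ⟨RelLoop.toLoop, RelLoop.ofLoop, RelLoop.ofLoop_toLoop, RelLoop.toLoop_ofLoop⟩
    RelLoop.homotopic_iff).trans MulOpposite.opEquiv

theorem equivPiGrp_mk (p : RelLoop P (n + 1)) :
    equivPiGrp P n (mk p) = PiGrp.mk (RelLoop.toLoop p) := rfl

/-- The group `π_{n+2}(S, B)`; the product is given by concatenation along any coordinate but the
last one, see `RelPi.mk_mul`. -/
instance (P : PPair.{u}) (n : ℕ) : Group (RelPi P (n + 1)) := (equivPiGrp P n).group

theorem equivPiGrp_mul (a b : RelPi P (n + 1)) :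
    equivPiGrp P n (a * b) = equivPiGrp P n a * equivPiGrp P n b :=
  (equivPiGrp P n).apply_symm_apply _

/-- The unit of `π_{n+2}(S, B)` is the class of the constant map. -/
theorem one_def : (1 : RelPi P (n + 1)) = mk RelLoop.const := by
  apply (equivPiGrp P n).injective
  exact (equivPiGrp P n).apply_symm_apply _

end RelPi

/-- Concatenation of maps of triples along the `i`-th coordinate, which is not the last one. -/
def RelLoop.transAt {P : PPair.{u}} {n : ℕ} (i : Fin n) (p q : RelLoop P n) : RelLoop P n :=
  RelLoop.ofLoop (GenLoop.transAt i (RelLoop.toLoop p) (RelLoop.toLoop q))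

theorem RelLoop.transAt_apply {P : PPair.{u}} {n : ℕ} (i : Fin n) (p q : RelLoop P n)
    (y : Fin (n + 1) → I) :
    (RelLoop.transAt i p q).toMap y =
      if (y i.castSucc : ℝ) ≤ 1 / 2
      then p.toMap (Function.update y i.castSucc
        (Set.projIcc 0 1 zero_le_one (2 * y i.castSucc : ℝ)))
      else q.toMap (Function.update y i.castSucc
        (Set.projIcc 0 1 zero_le_one (2 * y i.castSucc - 1 : ℝ))) := by
  have key : ∀ v, cubeSnoc (Function.update (fun j : Fin n => y j.castSucc) i v) (y (Fin.last n)) =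
      Function.update y i.castSucc v := by
    intro v
    conv_rhs => rw [← cubeSnoc_init y]
    exact Fin.snoc_update _ _ _ _
  change ((GenLoop.transAt i (RelLoop.toLoop p) (RelLoop.toLoop q))
    (fun j => y j.castSucc)).1.1 (y (Fin.last n)) = _
  simp only [GenLoop.transAt, GenLoop.coe_copy]
  split_ifs
  · exact congrArg p.toMap (key _)
  · exact congrArg q.toMap (key _)

theorem RelLoop.transAt_face {P : PPair.{u}} {n : ℕ} (i : Fin n) (p q : RelLoop P n) :
    (RelLoop.transAt i p q).face = GenLoop.transAt i p.face q.face := by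
  apply GenLoop.ext
  intro t
  change ((GenLoop.transAt i (RelLoop.toLoop p) (RelLoop.toLoop q)) t).1.2 = _
  simp only [GenLoop.transAt, GenLoop.coe_copy]
  split_ifs <;> rfl

namespace RelPi

variable {P Q : PPair.{u}} {n : ℕ}

theorem mk_mul (i : Fin (n + 1)) (p q : RelLoop P (n + 1)) :
    mk p * mk q = mk (RelLoop.transAt i p q) := by
  apply (equivPiGrp P n).injective
  rw [equivPiGrp_mul, equivPiGrp_mk, equivPiGrp_mk, equivPiGrp_mk, PiGrp.mk_mul i,
    RelLoop.transAt, RelLoop.toLoop_ofLoop]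

/-- The map induced on relative homotopy by a morphism of pairs. -/
def map (f : P ⟶ Q) (n : ℕ) : RelPi P n → RelPi Q n :=
  Quotient.map (RelLoop.map f) (fun _ _ h => h.map f)

theorem map_const (f : P ⟶ Q) : map f n (mk RelLoop.const) = mk RelLoop.const := by
  refine congrArg mk ?_
  apply RelLoop.ext
  · ext y
    change f.onSpace (P.incl P.pt) = Q.incl Q.pt
    rw [f.w, f.map_pt]
  · apply GenLoop.ext
    intro t
    exact f.map_pt

/-- The homomorphism induced on relative homotopy groups by a morphism of pairs. -/
def mapHom (f : P ⟶ Q) (n : ℕ) : RelPi P (n + 1) →* RelPi Q (n + 1) :=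
  MonoidHom.mk' (map f (n + 1)) (by
    intro a b
    induction a using RelPi.ind with
    | h p =>
    induction b using RelPi.ind with
    | h q =>
    rw [mk_mul 0]
    change mk (RelLoop.map f (RelLoop.transAt 0 p q)) =
      mk (RelLoop.map f p) * mk (RelLoop.map f q)
    rw [mk_mul 0]
    refine congrArg mk ?_
    apply RelLoop.ext
    · ext y
      change f.onSpace ((RelLoop.transAt 0 p q).toMap y) = _
      rw [RelLoop.transAt_apply, RelLoop.transAt_apply]
      split_ifs <;> rfl
    · rw [RelLoop.transAt_face]
      change genLoopMap f.onSub f.map_pt (RelLoop.transAt 0 p q).face = _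
      rw [RelLoop.transAt_face, genLoopMap_transAt]
      rfl)

/-- The map `π_{n+1}(S) → π_{n+1}(S, B)`. -/
def ofPi (P : PPair.{u}) (n : ℕ) (a : PiGrp n P.space (P.incl P.pt)) : RelPi P n :=
  Quotient.map (sa := GenLoop.Homotopic.setoid _ _) (sb := RelLoop.setoid P n)
    RelLoop.ofGenLoop (fun _ _ h => RelLoop.ofGenLoop_homotopic h) a.unop

/-- The homomorphism `π_{n+2}(S) → π_{n+2}(S, B)`. -/
def ofPiHom (P : PPair.{u}) (n : ℕ) : PiGrp (n + 1) P.space (P.incl P.pt) →* RelPi P (n + 1) :=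
  MonoidHom.mk' (ofPi P (n + 1)) (by
    intro a b
    induction a using PiGrp.ind with
    | h p =>
    induction b using PiGrp.ind with
    | h q =>
    rw [PiGrp.mk_mul (Fin.castSucc 0)]
    change mk (RelLoop.ofGenLoop (GenLoop.transAt (Fin.castSucc 0) p q)) =
      mk (RelLoop.ofGenLoop p) * mk (RelLoop.ofGenLoop q)
    rw [mk_mul 0]
    refine congrArg mk ?_
    apply RelLoop.ext
    · ext y
      rw [RelLoop.transAt_apply]
      change (GenLoop.transAt (Fin.castSucc 0) p q) y = _
      simp only [GenLoop.transAt, GenLoop.coe_copy]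
      split_ifs <;> rfl
    · rw [RelLoop.transAt_face]
      apply GenLoop.ext
      intro t
      simp only [GenLoop.transAt, GenLoop.coe_copy]
      split_ifs <;> rfl)

/-- The boundary homomorphism `π_{n+2}(S, B) → π_{n+1}(B)`: restriction to the distinguished
face. -/
def bdryHom (P : PPair.{u}) (n : ℕ) : RelPi P (n + 1) →* PiGrp n P.sub P.pt :=
  MonoidHom.mk'
    (Quotient.lift (fun p : RelLoop P (n + 1) => PiGrp.mk p.face) (by
      rintro p q ⟨H, -, h, rfl, rfl⟩
      refine PiGrp.sound ⟨⟨⟨⟨_, h⟩, fun _ => rfl, fun _ => rfl⟩, fun s t ht => ?_⟩⟩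
      exact ((H s).face.2 t ht).trans ((H 0).face.2 t ht).symm))
    (by
      intro a b
      induction a using RelPi.ind with
      | h p =>
      induction b using RelPi.ind with
      | h q =>
      rw [mk_mul 0]
      change PiGrp.mk (RelLoop.transAt 0 p q).face = PiGrp.mk p.face * PiGrp.mk q.face
      rw [RelLoop.transAt_face, PiGrp.mk_mul 0])

/-- The boundary map `π_1(S, B) → π_0(B)`: a path is sent to the component of its source. -/
def bdryZero (P : PPair.{u}) : RelPi P 0 → ZerothHomotopy P.sub :=
  Quotient.lift (fun p : RelLoop P 0 => ZerothHomotopy.mk (p.face 0)) (by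
    rintro p q ⟨H, -, h, rfl, rfl⟩
    exact ZerothHomotopy.sound ⟨⟨fun s => (H s).face 0, h.comp (by fun_prop :
      Continuous fun s : I => (s, (0 : Fin 0 → I)))⟩, rfl, rfl⟩)

end RelPi

/-! ### The right action of `π_1(S)` on `π_1(S, B)` -/

namespace RelLoop

variable {P Q : PPair.{u}}

/-- A one-dimensional map of triples, as a path from a point of `B` to the base point. -/
def toPath (p : RelLoop P 0) : Path (P.incl (p.face 0)) (P.incl P.pt) where
  toFun s := p.toMap (fun _ => s)
  continuous_toFun := by fun_prop
  source' := by
    rw [← p.toMap_face]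
    refine congrArg p.toMap (funext fun i => ?_)
    rw [Fin.eq_zero i]
    exact (Fin.snoc_last (α := fun _ => I) _ _).symm
  target' := p.toMap_J _ (Or.inl rfl)

/-- A path from a point of `B` to the base point, as a one-dimensional map of triples. -/
def ofPath (b : P.sub) (γ : Path (P.incl b) (P.incl P.pt)) : RelLoop P 0 where
  toMap := ⟨fun y => γ (y 0), by fun_prop⟩
  face := ⟨ContinuousMap.const _ b, fun _ ⟨i, _⟩ => i.elim0⟩
  toMap_face t := by
    change γ (cubeSnoc t 0 (Fin.last 0)) = P.incl b
    rw [cubeSnoc, Fin.snoc_last]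
    exact γ.source
  toMap_J y hy := by
    rcases hy with h | ⟨i, _⟩
    · change γ (y (Fin.last 0)) = _
      rw [h]
      exact γ.target
    · exact i.elim0

theorem toPath_ofPath (b : P.sub) (γ : Path (P.incl b) (P.incl P.pt)) :
    toPath (ofPath b γ) = γ := rfl

theorem ofPath_toPath (p : RelLoop P 0) : ofPath (p.face 0) (toPath p) = p := by
  apply RelLoop.ext
  · ext y
    change p.toMap (fun _ => y 0) = p.toMap y
    refine congrArg p.toMap (funext fun i => ?_)
    rw [Fin.eq_zero i]
  · apply GenLoop.ext
    intro t
    change p.face 0 = p.face t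
    rw [Subsingleton.elim t 0]

theorem ofPath_homotopic {b : P.sub} {γ γ' : Path (P.incl b) (P.incl P.pt)}
    (h : γ.Homotopic γ') : Homotopic (ofPath b γ) (ofPath b γ') := by
  obtain ⟨H⟩ := h
  refine ⟨fun s => ofPath b (H.eval s), ?_, continuous_const, ?_, ?_⟩
  · exact H.continuous.comp (by fun_prop : Continuous fun z : I × (Fin 1 → I) => (z.1, z.2 0))
  · exact congrArg _ (Path.Homotopy.eval_zero H)
  · exact congrArg _ (Path.Homotopy.eval_one H)

/-- Concatenation on the right with a loop at the base point. -/
def concat (p : RelLoop P 0) (c : Ω^ (Fin 1) P.space (P.incl P.pt)) : RelLoop P 0 :=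
  ofPath (p.face 0) ((toPath p).trans (genLoopEquivOfUnique (Fin 1) c))

theorem genLoopEquivOfUnique_homotopic {S : Type*} [TopologicalSpace S] {s : S}
    {c c' : Ω^ (Fin 1) S s} (h : GenLoop.Homotopic c c') :
    (genLoopEquivOfUnique (Fin 1) c : Path s s).Homotopic (genLoopEquivOfUnique (Fin 1) c') := by
  obtain ⟨H⟩ := h
  exact ⟨{  toFun := fun tx => H (tx.fst, fun _ => tx.snd)
            map_zero_left := fun _ => H.apply_zero _
            map_one_left := fun _ => H.apply_one _
            prop' := fun t y iH => H.prop' _ _ ⟨default, iH⟩ }⟩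

theorem concat_homotopic {p p' : RelLoop P 0} (h : Homotopic p p')
    {c c' : Ω^ (Fin 1) P.space (P.incl P.pt)} (h' : GenLoop.Homotopic c c') :
    Homotopic (concat p c) (concat p' c') := by
  refine (RelLoop.setoid P 0).trans (b := concat p' c) ?_
    (ofPath_homotopic (Path.Homotopic.hcomp (Path.Homotopic.refl _)
      (genLoopEquivOfUnique_homotopic h')))
  obtain ⟨H, h1, h2, rfl, rfl⟩ := h
  refine ⟨fun s => concat (H s) c, ?_, ?_, rfl, rfl⟩
  · have key := Path.trans_continuous_family (fun s : I => toPath (H s))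
      (h1.comp (by fun_prop : Continuous fun z : I × I => (z.1, (fun _ => z.2 : Fin 1 → I))))
      (fun _ : I => (genLoopEquivOfUnique (Fin 1) c : Path (P.incl P.pt) (P.incl P.pt)))
      ((genLoopEquivOfUnique (Fin 1) c : Path _ _).continuous.comp continuous_snd)
    exact key.comp (by fun_prop : Continuous fun z : I × (Fin 1 → I) => (z.1, z.2 0))
  · exact h2.comp (by fun_prop : Continuous fun z : I × (Fin 0 → I) => (z.1, (0 : Fin 0 → I)))

end RelLoop

namespace RelPi

variable {P Q : PPair.{u}}

/-- The right action of `π_1(S)` on `π_1(S, B)` by concatenation. -/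
def act (a : RelPi P 0) (c : PiGrp 0 P.space (P.incl P.pt)) : RelPi P 0 :=
  Quotient.map₂ (sa := RelLoop.setoid P 0) (sb := GenLoop.Homotopic.setoid _ _)
    (sc := RelLoop.setoid P 0) RelLoop.concat
    (fun _ _ h _ _ h' => RelLoop.concat_homotopic h h') a c.unop

theorem act_mk (p : RelLoop P 0) (c : Ω^ (Fin 1) P.space (P.incl P.pt)) :
    act (mk p) (PiGrp.mk c) = mk (RelLoop.concat p c) := rfl

theorem act_one (a : RelPi P 0) : act a 1 = a := by
  induction a using RelPi.ind with
  | h p =>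
  rw [← PiGrp.mk_const, act_mk]
  conv_rhs => rw [← RelLoop.ofPath_toPath p]
  exact sound (RelLoop.ofPath_homotopic ⟨Path.Homotopy.transRefl _⟩)

theorem act_mul (a : RelPi P 0) (c d : PiGrp 0 P.space (P.incl P.pt)) :
    act a (c * d) = act (act a c) d := by
  induction a using RelPi.ind with
  | h p =>
  induction c using PiGrp.ind with
  | h c =>
  induction d using PiGrp.ind with
  | h d =>
  rw [PiGrp.mk_mul default, act_mk, act_mk, act_mk, RelLoop.concat,
    HomotopyGroup.genLoopEquivOfUnique_transAt]
  exact (sound (RelLoop.ofPath_homotopic ⟨Path.Homotopy.transAssoc _ _ _⟩)).symm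

theorem map_act (f : P ⟶ Q) (a : RelPi P 0) (c : PiGrp 0 P.space (P.incl P.pt)) :
    map f 0 (act a c) =
      act (map f 0 a) (PiGrp.map 0 f.onSpace (PPair.toSpace.map f).map_pt c) := by
  induction a using RelPi.ind with
  | h p =>
  induction c using PiGrp.ind with
  | h c =>
  change mk (RelLoop.map f (RelLoop.concat p c)) = mk (RelLoop.concat (RelLoop.map f p)
    (genLoopMap f.onSpace (PPair.toSpace.map f).map_pt c))
  refine congrArg mk ?_
  apply RelLoop.ext
  · ext y
    change f.onSpace (((RelLoop.toPath p).trans _) (y 0)) = (Path.trans _ _) (y 0)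
    rw [Path.trans_apply, Path.trans_apply]
    split_ifs <;> rfl
  · rfl

/-- The action `(π_1(S, B), π_1(S))`, pointed at the class of the constant path. -/
def actOne (P : PPair.{u}) : Act.{u} where
  pts := RelPi P 0
  base := mk RelLoop.const
  grp := PiGrp 0 P.space (P.incl P.pt)
  act := act
  act_one := act_one
  act_mul := act_mul

end RelPi

/-- `π_0(S, B)`, by definition the cokernel of `π_0(B) → π_0(S)`. -/
def relPi0Act : PPair.{u} ⥤ Act.{u} where
  obj P := Act.coker (pi0Act.map (PPair.inclNat.app P))
  map f := Act.cokerMap (pi0Act.map (PPair.toSub.map f)) (pi0Act.map (PPair.toSpace.map f)) (by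
    rw [← pi0Act.map_comp, ← pi0Act.map_comp, PPair.inclNat.naturality])
  map_id _ := Act.hom_ext (by rintro ⟨⟨x⟩⟩; rfl) (fun _ => rfl)
  map_comp _ _ := Act.hom_ext (by rintro ⟨⟨x⟩⟩; rfl) (fun _ => rfl)

/-- The functor `(S, B) ↦ (π_1(S, B), π_1(S))`. -/
def relPi1Act : PPair.{u} ⥤ Act.{u} where
  obj := RelPi.actOne
  map f :=
    { onPts := RelPi.map f 0
      onGrp := PiGrp.map 0 f.onSpace (PPair.toSpace.map f).map_pt
      map_base := RelPi.map_const f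
      map_act := RelPi.map_act f }
  map_id _ := Act.hom_ext (RelPi.ind fun _ => rfl) (PiGrp.ind fun _ => rfl)
  map_comp _ _ := Act.hom_ext (RelPi.ind fun _ => rfl) (PiGrp.ind fun _ => rfl)

/-- The functor `(S, B) ↦ π_{n+2}(S, B)`, with values in actions of groups on themselves. -/
def relPiGrpAct (n : ℕ) : PPair.{u} ⥤ Act.{u} where
  obj P := Act.ofGroup (RelPi P (n + 1))
  map f := Act.ofGroupMap (RelPi.mapHom f n)
  map_id _ := Act.hom_ext (RelPi.ind fun _ => rfl) (RelPi.ind fun _ => rfl)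
  map_comp f g := by
    have key : ∀ a, RelPi.map (f ≫ g) (n + 1) a = RelPi.map g (n + 1) (RelPi.map f (n + 1) a) :=
      RelPi.ind fun _ => rfl
    exact Act.hom_ext key key

/-- The `n`-th relative homotopy of pointed pairs, with values in actions. -/
def relPiAct : ℕ → (PPair.{u} ⥤ Act.{u})
  | 0 => relPi0Act
  | 1 => relPi1Act
  | n + 2 => relPiGrpAct n

/-! ### The relative homotopy sequence of pointed pairs -/

/-- The morphism `π_n(B) → π_n(S)` induced by the inclusion. -/
def inclAct (n : ℕ) : PPair.toSub.{u} ⋙ piAct n ⟶ PPair.toSpace ⋙ piAct n :=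
  Functor.whiskerRight PPair.inclNat (piAct n)

/-- The morphism `π_n(S) → π_n(S, B)`: for `n = 0` the projection onto the cokernel, for `n = 1` the
morphism `σ ↦ (0 · σ, σ)`, and for `n ≥ 2` the homomorphism that views a map constant on the
boundary as a map of triples. -/
def relAct : ∀ n : ℕ, PPair.toSpace.{u} ⋙ piAct n ⟶ relPiAct n
  | 0 =>
    { app := fun P => Act.cokerπ (pi0Act.map (PPair.inclNat.app P))
      naturality := fun _ _ _ => Act.hom_ext (by rintro ⟨x⟩; rfl) (fun _ => rfl) }
  | 1 =>
    { app := fun P =>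
        { onPts := fun c => RelPi.act (RelPi.mk RelLoop.const) c
          onGrp := MonoidHom.id _
          map_base := RelPi.act_one _
          map_act := fun c d => RelPi.act_mul _ c d }
      naturality := fun P Q f => Act.hom_ext
        (fun c => ((RelPi.map_act f (RelPi.mk RelLoop.const) c).trans
          (by rw [RelPi.map_const]; rfl)).symm) (fun _ => rfl) }
  | n + 2 =>
    { app := fun P => Act.ofGroupMap (RelPi.ofPiHom P n)
      naturality := fun P Q f => by
        have key : ∀ c, RelPi.ofPi Q (n + 1)
            (PiGrp.map (n + 1) f.onSpace (PPair.toSpace.map f).map_pt c) =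
            RelPi.map f (n + 1) (RelPi.ofPi P (n + 1) c) := by
          intro c
          induction c using PiGrp.ind with
          | h c =>
          refine congrArg RelPi.mk ?_
          apply RelLoop.ext
          · rfl
          · apply GenLoop.ext
            intro t
            exact f.map_pt.symm
        exact Act.hom_ext key key }

/-- The morphism `∂ : π_{n+1}(S, B) → π_n(B)` given by restriction to the distinguished face. -/
def bdryAct : ∀ n : ℕ, relPiAct.{u} (n + 1) ⟶ PPair.toSub ⋙ piAct n
  | 0 =>
    { app := fun P =>
        { onPts := RelPi.bdryZero P
          onGrp := 1
          map_base := rfl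
          map_act := fun a c => by
            induction a using RelPi.ind with
            | h p =>
            induction c using PiGrp.ind with
            | h c => rfl }
      naturality := fun P Q f => Act.hom_ext (RelPi.ind fun _ => rfl) (fun _ => rfl) }
  | n + 1 =>
    { app := fun P => Act.ofGroupMap (RelPi.bdryHom P n)
      naturality := fun P Q f =>
        Act.hom_ext (RelPi.ind fun _ => rfl) (RelPi.ind fun _ => rfl) }

/-! ### Directed spaces and traces -/

/-- Directed spaces. -/
structure Dispace : Type (u + 1) where
  carrier : Type u
  [top : TopologicalSpace carrier]
  dipaths : Set C(I, carrier)
  const_mem : ∀ x, ContinuousMap.const I x ∈ dipaths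
  reparam_mem : ∀ p ∈ dipaths, ∀ φ : C(I, I), Monotone φ → p.comp φ ∈ dipaths
  trans_mem : ∀ {x y z : carrier} (p : Path x y) (q : Path y z),
    p.toContinuousMap ∈ dipaths → q.toContinuousMap ∈ dipaths →
      (p.trans q).toContinuousMap ∈ dipaths

attribute [instance] Dispace.top

/-- Directed subspaces of a dispace: dispaces whose space is a subspace and whose dipaths are
dipaths of the ambient dispace. -/
structure DirectedSubspace (X : Dispace.{u}) : Type u where
  carrier : Set X.carrier
  dipaths : Set C(I, carrier)
  const_mem : ∀ x, ContinuousMap.const I x ∈ dipaths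
  reparam_mem : ∀ p ∈ dipaths, ∀ φ : C(I, I), Monotone φ → p.comp φ ∈ dipaths
  trans_mem : ∀ {x y z : carrier} (p : Path x y) (q : Path y z),
    p.toContinuousMap ∈ dipaths → q.toContinuousMap ∈ dipaths →
      (p.trans q).toContinuousMap ∈ dipaths
  incl_mem : ∀ p ∈ dipaths, (⟨Subtype.val, continuous_subtype_val⟩ : C(carrier, X.carrier)).comp p ∈
    X.dipaths

/-- The dispace underlying a directed subspace. -/
def DirectedSubspace.toDispace {X : Dispace.{u}} (A : DirectedSubspace X) : Dispace.{u} where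
  carrier := A.carrier
  dipaths := A.dipaths
  const_mem := A.const_mem
  reparam_mem := A.reparam_mem
  trans_mem := A.trans_mem

/-- The space of dipaths from `x` to `y`, with the compact-open topology. -/
abbrev Dipath (X : Dispace.{u}) (x y : X.carrier) : Type u :=
  {p : Path x y // p.toContinuousMap ∈ X.dipaths}

namespace Dipath

variable {X : Dispace.{u}} {x y z w : X.carrier}

/-- The dipath `q` is a monotonic reparametrization of `p`. -/
def IsReparam (p q : Dipath X x y) : Prop :=
  ∃ φ : C(I, I), Monotone φ ∧ φ 0 = 0 ∧ φ 1 = 1 ∧ ∀ t, q.1 t = p.1 (φ t)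

/-- The constant dipath. -/
def refl (x : X.carrier) : Dipath X x x := ⟨Path.refl x, X.const_mem x⟩

/-- Concatenation of dipaths. -/
def trans (p : Dipath X x y) (q : Dipath X y z) : Dipath X x z :=
  ⟨p.1.trans q.1, X.trans_mem _ _ p.2 q.2⟩

theorem continuous_trans :
    Continuous (fun z : Dipath X x y × Dipath X y z => trans z.1 z.2) :=
  Continuous.subtype_mk (Path.continuous_trans.comp
    (Continuous.prodMk (continuous_subtype_val.comp continuous_fst)
      (continuous_subtype_val.comp continuous_snd))) _

theorem IsReparam.refl (p : Dipath X x y) : IsReparam p p :=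
  ⟨ContinuousMap.id I, monotone_id, rfl, rfl, fun _ => rfl⟩

theorem IsReparam.trans {p p' : Dipath X x y} {q q' : Dipath X y z} (h : IsReparam p p')
    (h' : IsReparam q q') : IsReparam (p.trans q) (p'.trans q') := by
  obtain ⟨φ, hφ, h0, h1, hp⟩ := h
  obtain ⟨ψ, hψ, k0, k1, hq⟩ := h'
  let α : Path (0 : I) 1 := ⟨φ, h0, h1⟩
  let β : Path (0 : I) 1 := ⟨ψ, k0, k1⟩
  let lo : C(I, I) := ⟨fun s => ⟨(s : ℝ) / 2, by constructor <;> linarith [s.2.1, s.2.2]⟩,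
    by fun_prop⟩
  let hi : C(I, I) := ⟨fun s => ⟨((s : ℝ) + 1) / 2, by constructor <;> linarith [s.2.1, s.2.2]⟩,
    by fun_prop⟩
  have hlo : Monotone lo := fun s t h => by
    change (s : ℝ) / 2 ≤ (t : ℝ) / 2
    have : (s : ℝ) ≤ t := h
    linarith
  have hhi : Monotone hi := fun s t h => by
    change ((s : ℝ) + 1) / 2 ≤ ((t : ℝ) + 1) / 2
    have : (s : ℝ) ≤ t := h
    linarith
  let γ : Path (lo 0) (hi 1) :=
    (α.map lo.continuous).trans ((β.map hi.continuous).cast (by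
      ext
      change (1 : ℝ) / 2 = ((0 : ℝ) + 1) / 2
      norm_num) rfl)
  have hγ : ∀ t : I, (γ t : ℝ) = if h : (t : ℝ) ≤ 1 / 2
      then (φ ⟨2 * t, (unitInterval.mul_pos_mem_iff zero_lt_two).2 ⟨t.2.1, h⟩⟩ : ℝ) / 2
      else ((ψ ⟨2 * t - 1, unitInterval.two_mul_sub_one_mem_iff.2
        ⟨(not_le.1 h).le, t.2.2⟩⟩ : ℝ) + 1) / 2 := by
    intro t
    change (((α.map lo.continuous).trans _ : Path _ _) t : ℝ) = _
    rw [Path.trans_apply]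
    split_ifs <;> rfl
  refine ⟨⟨γ, γ.continuous⟩, ?_, ?_, ?_, ?_⟩
  · intro s t hst
    have hst' : (s : ℝ) ≤ t := hst
    change (γ s : ℝ) ≤ γ t
    rw [hγ, hγ]
    split_ifs with a b b
    · have key : (⟨2 * s, (unitInterval.mul_pos_mem_iff zero_lt_two).2 ⟨s.2.1, a⟩⟩ : I) ≤
          ⟨2 * t, (unitInterval.mul_pos_mem_iff zero_lt_two).2 ⟨t.2.1, b⟩⟩ := by
        change (2 * s : ℝ) ≤ 2 * t
        linarith
      have := Subtype.coe_le_coe.2 (hφ key)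
      linarith
    · have e1 := (φ ⟨2 * s, (unitInterval.mul_pos_mem_iff zero_lt_two).2 ⟨s.2.1, a⟩⟩).2.2
      have e2 := (ψ ⟨2 * t - 1, unitInterval.two_mul_sub_one_mem_iff.2
        ⟨(not_le.1 b).le, t.2.2⟩⟩).2.1
      linarith
    · exact absurd (hst'.trans b) a
    · have key : (⟨2 * s - 1, unitInterval.two_mul_sub_one_mem_iff.2
          ⟨(not_le.1 a).le, s.2.2⟩⟩ : I) ≤ ⟨2 * t - 1, unitInterval.two_mul_sub_one_mem_iff.2
          ⟨(not_le.1 b).le, t.2.2⟩⟩ := by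
        change (2 * s - 1 : ℝ) ≤ 2 * t - 1
        linarith
      have := Subtype.coe_le_coe.2 (hψ key)
      linarith
  · ext
    change (γ 0 : ℝ) = 0
    rw [γ.source]
    change (0 : ℝ) / 2 = 0
    norm_num
  · ext
    change (γ 1 : ℝ) = 1
    rw [γ.target]
    change ((1 : ℝ) + 1) / 2 = 1
    norm_num
  · intro t
    change (p'.1.trans q'.1) t = (p.1.trans q.1) (γ t)
    rw [Path.trans_apply, Path.trans_apply]
    have := hγ t
    split_ifs at this with a
    · have e1 := (φ ⟨2 * t, (unitInterval.mul_pos_mem_iff zero_lt_two).2 ⟨t.2.1, a⟩⟩).2.2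
      rw [dif_pos a, dif_pos (by rw [this]; linarith), hp]
      refine congrArg p.1 ?_
      ext
      change _ = 2 * (γ t : ℝ)
      rw [this]
      ring
    · rw [dif_neg a]
      set s : I := ⟨2 * t - 1, unitInterval.two_mul_sub_one_mem_iff.2 ⟨(not_le.1 a).le, t.2.2⟩⟩
        with hs
      rcases (ψ s).2.1.eq_or_lt with e | e
      · have e' : (γ t : ℝ) = 1 / 2 := by rw [this, ← e]; norm_num
        rw [dif_pos e'.le, hq, show ψ s = 0 from Subtype.ext e.symm, q.1.source]
        symm
        convert p.1.target using 2
        ext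
        change 2 * (γ t : ℝ) = 1
        rw [e']; norm_num
      · rw [dif_neg (by rw [this]; linarith), hq]
        refine congrArg q.1 ?_
        ext
        change _ = 2 * (γ t : ℝ) - 1
        rw [this]
        ring

theorem isReparam_trans_refl (p : Dipath X x y) : IsReparam p (p.trans (refl y)) := by
  refine ⟨⟨fun t => ⟨Path.Homotopy.transReflReparamAux t,
    Path.Homotopy.transReflReparamAux_mem_I t⟩, by fun_prop⟩, ?_, ?_, ?_, ?_⟩
  · intro s t h
    have h' : (s : ℝ) ≤ t := h
    change Path.Homotopy.transReflReparamAux s ≤ Path.Homotopy.transReflReparamAux t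
    unfold Path.Homotopy.transReflReparamAux
    split_ifs <;> linarith [s.2.2]
  · exact Subtype.ext Path.Homotopy.transReflReparamAux_zero
  · exact Subtype.ext Path.Homotopy.transReflReparamAux_one
  · intro t
    exact congrArg (fun γ : Path x y => γ t) (Path.Homotopy.trans_refl_reparam p.1)

theorem isReparam_refl_trans (p : Dipath X x y) : IsReparam p ((refl x).trans p) := by
  refine ⟨⟨fun t => Set.projIcc 0 1 zero_le_one (2 * t - 1 : ℝ), by fun_prop⟩, ?_, ?_, ?_, ?_⟩
  · intro s t h
    have h' : (s : ℝ) ≤ t := h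
    exact Set.monotone_projIcc zero_le_one (by linarith)
  · exact Set.projIcc_of_le_left zero_le_one (by norm_num)
  · exact Set.projIcc_of_right_le zero_le_one (by norm_num)
  · intro t
    change ((Path.refl x).trans p.1) t = p.1 (Set.projIcc 0 1 zero_le_one (2 * t - 1 : ℝ))
    rw [Path.trans_apply]
    split_ifs with a
    · rw [Set.projIcc_of_le_left zero_le_one (by linarith : (2 * t - 1 : ℝ) ≤ 0)]
      exact p.1.source.symm
    · refine congrArg p.1 ?_
      rw [Set.projIcc_of_mem _ (unitInterval.two_mul_sub_one_mem_iff.2 ⟨(not_le.1 a).le, t.2.2⟩)]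

theorem isReparam_assoc (p : Dipath X x y) (q : Dipath X y z) (r : Dipath X z w) :
    IsReparam (p.trans (q.trans r)) ((p.trans q).trans r) := by
  refine ⟨⟨fun t => ⟨Path.Homotopy.transAssocReparamAux t,
    Path.Homotopy.transAssocReparamAux_mem_I t⟩, by fun_prop⟩, ?_, ?_, ?_, ?_⟩
  · intro s t h
    have h' : (s : ℝ) ≤ t := h
    change Path.Homotopy.transAssocReparamAux s ≤ Path.Homotopy.transAssocReparamAux t
    unfold Path.Homotopy.transAssocReparamAux
    split_ifs <;> linarith [s.2.1, t.2.2]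
  · exact Subtype.ext Path.Homotopy.transAssocReparamAux_zero
  · exact Subtype.ext Path.Homotopy.transAssocReparamAux_one
  · intro t
    exact congrArg (fun γ : Path x w => γ t) (Path.Homotopy.trans_assoc_reparam p.1 q.1 r.1)

end Dipath

/-- The space of traces from `x` to `y`: the quotient of the space of dipaths by (the equivalence
relation generated by) monotonic reparametrization, with the quotient topology. -/
abbrev Trace (X : Dispace.{u}) (x y : X.carrier) : Type u :=
  Quot (Dipath.IsReparam (X := X) (x := x) (y := y))

namespace Trace

variable {X : Dispace.{u}} {x y z w : X.carrier}

/-- The trace of a dipath. -/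
abbrev mk (p : Dipath X x y) : Trace X x y := Quot.mk _ p

/-- Concatenation of traces. -/
def trans (a : Trace X x y) (b : Trace X y z) : Trace X x z :=
  Quot.map₂ Dipath.trans (fun p _ _ h => (Dipath.IsReparam.refl p).trans h)
    (fun _ _ q h => h.trans (Dipath.IsReparam.refl q)) a b

theorem continuous_trans_left (a : Trace X x y) :
    Continuous (fun b : Trace X y z => trans a b) := by
  obtain ⟨p⟩ := a
  exact isQuotientMap_quot_mk.continuous_iff.2 (continuous_quot_mk.comp
    (Dipath.continuous_trans.comp (by fun_prop : Continuous fun q : Dipath X y z => (p, q))))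

theorem continuous_trans_right (b : Trace X y z) :
    Continuous (fun a : Trace X x y => trans a b) := by
  obtain ⟨q⟩ := b
  exact isQuotientMap_quot_mk.continuous_iff.2 (continuous_quot_mk.comp
    (Dipath.continuous_trans.comp (by fun_prop : Continuous fun p : Dipath X x y => (p, q))))

end Trace
/-- The objects of the trace category of `X`: the points of `X`. -/
structure TraceCat (X : Dispace.{u}) : Type u where
  pt : X.carrier

/-- The trace category: morphisms are traces, composition is concatenation. -/
instance (X : Dispace.{u}) : Category.{u} (TraceCat X) where
  Hom x y := Trace X x.pt y.pt
  id x := Trace.mk (Dipath.refl x.pt)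
  comp a b := Trace.trans a b
  id_comp := by rintro x y ⟨p⟩; exact (Quot.sound p.isReparam_refl_trans).symm
  comp_id := by rintro x y ⟨p⟩; exact (Quot.sound p.isReparam_trans_refl).symm
  assoc := by rintro x y z w ⟨p⟩ ⟨q⟩ ⟨r⟩; exact (Quot.sound (Dipath.isReparam_assoc p q r)).symm

/-- The pointed trace diagram of `X`: it sends a trace `f` from `x` to `y` to the space of traces
from `x` to `y`, pointed at `f`, and `(u, v)` to the concatenation with `u` and `v`. -/
def traceDiagram (X : Dispace.{u}) : Factn (TraceCat X) ⥤ PTop.{u} where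
  obj f := ⟨Trace X f.src.pt f.tgt.pt, f.arr⟩
  map {f f'} a :=
    { map := ⟨fun g => Trace.trans a.left (Trace.trans g a.right),
        (Trace.continuous_trans_left _).comp (Trace.continuous_trans_right _)⟩
      map_pt := a.w }
  map_id f := by
    apply PTop.Hom.ext
    apply ContinuousMap.ext
    intro g
    let g' : f.src ⟶ f.tgt := g
    change 𝟙 f.src ≫ (g' ≫ 𝟙 f.tgt) = g'
    simp
  map_comp {f f' f''} a b := by
    apply PTop.Hom.ext
    apply ContinuousMap.ext
    intro g
    let g' : f.src ⟶ f.tgt := g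
    change (b.left ≫ a.left) ≫ (g' ≫ (a.right ≫ b.right)) =
      b.left ≫ ((a.left ≫ (g' ≫ a.right)) ≫ b.right)
    simp

/-- The `n`-th natural homotopy of `X`: the homotopy `π_{n-1}` of the pointed trace diagram for
`n ≥ 1`, and trivial for `n = 0`. -/
def natHomotopy (X : Dispace.{u}) : ℕ → NatSys (TraceCat X) Act.{u}
  | 0 => (Functor.const _).obj Act.zero
  | n + 1 => traceDiagram X ⋙ piAct n

/-! ### Relative natural homotopy -/

/-- Two monotonic surjections of the unit interval have a common monotonic reparametrization. -/
theorem exists_common_reparam {φ ψ : C(I, I)} (hφ : Monotone φ) (hψ : Monotone ψ)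
    (h0 : φ 0 = 0) (h1 : φ 1 = 1) (k0 : ψ 0 = 0) (k1 : ψ 1 = 1) :
    ∃ α β : C(I, I), Monotone α ∧ Monotone β ∧ α 0 = 0 ∧ α 1 = 1 ∧ β 0 = 0 ∧ β 1 = 1 ∧
      ∀ t, φ (α t) = ψ (β t) := by
  let F : ℝ → ℝ := fun s => φ (Set.projIcc 0 1 zero_le_one s)
  let G : ℝ → ℝ := fun s => ψ (Set.projIcc 0 1 zero_le_one s)
  have hF : Monotone F := fun s t h =>
    Subtype.coe_le_coe.2 (hφ (Set.monotone_projIcc zero_le_one h))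
  have hG : Monotone G := fun s t h =>
    Subtype.coe_le_coe.2 (hψ (Set.monotone_projIcc zero_le_one h))
  have cF : Continuous F := by fun_prop
  have cG : Continuous G := by fun_prop
  have F0 : ∀ s ≤ 0, F s = 0 := fun s hs => by
    simp only [F, Set.projIcc_of_le_left zero_le_one hs]
    exact congrArg Subtype.val h0
  have F1 : ∀ s, 1 ≤ s → F s = 1 := fun s hs => by
    simp only [F, Set.projIcc_of_right_le zero_le_one hs]
    exact congrArg Subtype.val h1
  have G0 : ∀ s ≤ 0, G s = 0 := fun s hs => by
    simp only [G, Set.projIcc_of_le_left zero_le_one hs]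
    exact congrArg Subtype.val k0
  have G1 : ∀ s, 1 ≤ s → G s = 1 := fun s hs => by
    simp only [G, Set.projIcc_of_right_le zero_le_one hs]
    exact congrArg Subtype.val k1
  have Fnn : ∀ s, 0 ≤ F s := fun s => (φ _).2.1
  have Fle : ∀ s, F s ≤ 1 := fun s => (φ _).2.2
  have Gnn : ∀ s, 0 ≤ G s := fun s => (ψ _).2.1
  have Gle : ∀ s, G s ≤ 1 := fun s => (ψ _).2.2
  -- `a w` is the largest `s` with `F s ≤ G (w - s)`
  let S : ℝ → Set ℝ := fun w => {s | 0 ≤ s ∧ s ≤ 1 ∧ s ≤ w ∧ F s ≤ G (w - s)}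
  let a : ℝ → ℝ := fun w => sSup (S w)
  have S0 : ∀ w, 0 ≤ w → (0 : ℝ) ∈ S w := fun w hw =>
    ⟨le_rfl, zero_le_one, hw, by rw [F0 0 le_rfl]; exact Gnn _⟩
  have Sbdd : ∀ w, BddAbove (S w) := fun w => ⟨1, fun s hs => hs.2.1⟩
  have Scl : ∀ w, IsClosed (S w) := fun w => by
    have : S w = Set.Ici 0 ∩ (Set.Iic 1 ∩ (Set.Iic w ∩ {s | F s ≤ G (w - s)})) := rfl
    rw [this]
    exact isClosed_Ici.inter (isClosed_Iic.inter (isClosed_Iic.inter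
      (isClosed_le cF (cG.comp (by fun_prop)))))
  have amem : ∀ w, 0 ≤ w → a w ∈ S w := fun w hw =>
    (Scl w).csSup_mem ⟨0, S0 w hw⟩ (Sbdd w)
  have amono : ∀ w w', 0 ≤ w → w ≤ w' → a w ≤ a w' := fun w w' hw h => by
    obtain ⟨p, q, r, s⟩ := amem w hw
    exact le_csSup (Sbdd w') ⟨p, q, r.trans h, s.trans (hG (by linarith))⟩
  have alip : ∀ w w', 0 ≤ w → w ≤ w' → a w' ≤ a w + (w' - w) := fun w w' hw h => by
    obtain ⟨p, q, r, s⟩ := amem w' (hw.trans h)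
    by_cases hc : a w' ≤ w' - w
    · linarith [(amem w hw).1]
    · have : a w' - (w' - w) ∈ S w := by
        refine ⟨by linarith, by linarith, by linarith, ?_⟩
        refine (hF (by linarith : a w' - (w' - w) ≤ a w')).trans (s.trans (hG (by linarith)))
      linarith [le_csSup (Sbdd w) this]
  have aeq : ∀ w, 0 ≤ w → w ≤ 2 → F (a w) = G (w - a w) ∧ w - a w ≤ 1 := fun w hw hw2 => by
    obtain ⟨p, q, r, s⟩ := amem w hw
    have hle : w - a w ≤ 1 := by
      by_cases hw1 : w ≤ 1
      · linarith
      · have hm : w - 1 ∈ S w := ⟨by linarith, by linarith, by linarith, by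
          rw [G1 _ (by linarith)]; exact Fle _⟩
        linarith [le_csSup (Sbdd w) hm]
    refine ⟨le_antisymm s ?_, hle⟩
    rcases r.eq_or_lt with r | r
    · rw [G0 (w - a w) (by linarith)]; exact Fnn _
    rcases q.eq_or_lt with q | q
    · rw [q, F1 1 le_rfl]; exact Gle _
    have hev : ∀ᶠ s in nhdsWithin (a w) (Set.Ioi (a w)), G (w - s) ≤ F s := by
      have h1 : ∀ᶠ s in nhdsWithin (a w) (Set.Ioi (a w)), s < min 1 w :=
        nhdsWithin_le_nhds (Iio_mem_nhds (lt_min q r))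
      filter_upwards [h1, self_mem_nhdsWithin] with s hs hs'
      have hs'' : a w < s := hs'
      by_contra hcon
      have hm : s ∈ S w := ⟨by linarith, (hs.le.trans (min_le_left _ _)),
        (hs.le.trans (min_le_right _ _)), (not_le.1 hcon).le⟩
      linarith [le_csSup (Sbdd w) hm]
    exact le_of_tendsto_of_tendsto
      ((cG.comp (by fun_prop : Continuous fun s : ℝ => w - s)).continuousAt.mono_left
        nhdsWithin_le_nhds) (cF.continuousAt.mono_left nhdsWithin_le_nhds) hev
  have mem2 : ∀ t : I, 0 ≤ 2 * (t : ℝ) ∧ 2 * (t : ℝ) ≤ 2 := fun t =>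
    ⟨by linarith [t.2.1], by linarith [t.2.2]⟩
  have acont : Continuous fun t : I => a (2 * t) := by
    have : LipschitzWith 2 fun t : I => a (2 * t) := by
      refine LipschitzWith.of_le_add_mul 2 fun s t => ?_
      have hd : dist s t = |(s : ℝ) - t| := rfl
      rw [hd]
      rcases le_total (s : ℝ) t with h | h
      · have := amono (2 * s) (2 * t) (mem2 s).1 (by linarith)
        have h2 := abs_nonneg ((s : ℝ) - t)
        push_cast
        linarith
      · have := alip (2 * t) (2 * s) (mem2 t).1 (by linarith)
        rw [abs_of_nonneg (by linarith)]
        push_cast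
        linarith
    exact this.continuous
  refine ⟨⟨fun t => ⟨a (2 * t), (amem _ (mem2 t).1).1, (amem _ (mem2 t).1).2.1⟩,
    acont.subtype_mk _⟩,
    ⟨fun t => ⟨2 * t - a (2 * t), by linarith [(amem _ (mem2 t).1).2.2.1],
      (aeq _ (mem2 t).1 (mem2 t).2).2⟩,
    ((by fun_prop : Continuous fun t : I => 2 * (t : ℝ)).sub acont).subtype_mk _⟩, ?_, ?_, ?_, ?_, ?_, ?_, ?_⟩
  · intro s t h
    have h' : (s : ℝ) ≤ t := h
    exact amono _ _ (mem2 s).1 (by linarith)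
  · intro s t h
    have h' : (s : ℝ) ≤ t := h
    have := alip (2 * s) (2 * t) (mem2 s).1 (by linarith)
    change 2 * (s : ℝ) - a (2 * s) ≤ 2 * (t : ℝ) - a (2 * t)
    linarith
  · ext
    change a (2 * (0 : ℝ)) = 0
    have := amem (2 * (0 : ℝ)) (by norm_num)
    linarith [this.1, this.2.2.1]
  · ext
    change a (2 * (1 : ℝ)) = 1
    have := amem (2 * (1 : ℝ)) (by norm_num)
    linarith [this.2.1, (aeq (2 * (1 : ℝ)) (by norm_num) (by norm_num)).2]
  · ext
    change 2 * (0 : ℝ) - a (2 * (0 : ℝ)) = 0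
    have := amem (2 * (0 : ℝ)) (by norm_num)
    linarith [this.1, this.2.2.1]
  · ext
    change 2 * (1 : ℝ) - a (2 * (1 : ℝ)) = 1
    have := amem (2 * (1 : ℝ)) (by norm_num)
    linarith [this.2.1, (aeq (2 * (1 : ℝ)) (by norm_num) (by norm_num)).2]
  · intro t
    ext
    have e := (aeq _ (mem2 t).1 (mem2 t).2).1
    simp only [F, G] at e
    rw [Set.projIcc_of_mem zero_le_one ⟨(amem _ (mem2 t).1).1, (amem _ (mem2 t).1).2.1⟩,
      Set.projIcc_of_mem zero_le_one ⟨by linarith [(amem _ (mem2 t).1).2.2.1],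
      (aeq _ (mem2 t).1 (mem2 t).2).2⟩] at e
    exact e

/-- Two dipaths have the same trace if and only if they have a common reparametrization. -/
theorem Trace.mk_eq_iff {X : Dispace.{u}} {x y : X.carrier} (p q : Dipath X x y) :
    Trace.mk p = Trace.mk q ↔ ∃ r, Dipath.IsReparam p r ∧ Dipath.IsReparam q r := by
  constructor
  · intro h
    have h' := Quot.eqvGen_exact h
    clear h
    induction h' with
    | rel p q h => exact ⟨q, h, Dipath.IsReparam.refl q⟩
    | refl p => exact ⟨p, Dipath.IsReparam.refl p, Dipath.IsReparam.refl p⟩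
    | symm p q _ ih =>
      obtain ⟨r, h1, h2⟩ := ih
      exact ⟨r, h2, h1⟩
    | trans p q r _ _ ih ih' =>
      obtain ⟨a, ha, φ, hφ, h0, h1, hqa⟩ := ih
      obtain ⟨b, ⟨ψ, hψ, k0, k1, hqb⟩, hb⟩ := ih'
      obtain ⟨φ₁, m1, n0, n1, hpa⟩ := ha
      obtain ⟨ψ₁, m2, l0, l1, hrb⟩ := hb
      obtain ⟨α, β, mα, mβ, a0, a1, b0, b1, e⟩ := exists_common_reparam hφ hψ h0 h1 k0 k1
      refine ⟨⟨⟨a.1.toContinuousMap.comp α, ?_, ?_⟩, X.reparam_mem _ a.2 _ mα⟩,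
        ⟨φ₁.comp α, m1.comp mα, ?_, ?_, fun t => hpa _⟩,
        ⟨ψ₁.comp β, m2.comp mβ, ?_, ?_, fun t => ?_⟩⟩
      · change a.1 (α 0) = x
        rw [a0, a.1.source]
      · change a.1 (α 1) = y
        rw [a1, a.1.target]
      · change φ₁ (α 0) = 0
        rw [a0, n0]
      · change φ₁ (α 1) = 1
        rw [a1, n1]
      · change ψ₁ (β 0) = 0
        rw [b0, l0]
      · change ψ₁ (β 1) = 1
        rw [b1, l1]
      · change a.1 (α t) = r.1 (ψ₁ (β t))
        rw [← hrb, hqb, hqa, e]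
  · rintro ⟨r, h1, h2⟩
    exact (Quot.sound h1).trans (Quot.sound h2).symm

namespace DirectedSubspace

variable {X : Dispace.{u}} (A : DirectedSubspace X)

/-- A dipath of the subspace, viewed in the ambient dispace. -/
def dipathIncl {x y : A.toDispace.carrier} (p : Dipath A.toDispace x y) : Dipath X x.1 y.1 :=
  ⟨p.1.map continuous_subtype_val, A.incl_mem _ p.2⟩

theorem dipathIncl_trans {x y z : A.toDispace.carrier} (p : Dipath A.toDispace x y)
    (q : Dipath A.toDispace y z) :
    A.dipathIncl (p.trans q) = (A.dipathIncl p).trans (A.dipathIncl q) :=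
  Subtype.ext (Path.map_trans _ _ continuous_subtype_val)

/-- A trace of the subspace, viewed in the ambient dispace. -/
def traceIncl (x y : A.toDispace.carrier) :
    C(Trace A.toDispace x y, Trace X x.1 y.1) where
  toFun := Quot.map A.dipathIncl (by
    rintro p q ⟨φ, hφ, h0, h1, h⟩
    exact ⟨φ, hφ, h0, h1, fun t => congrArg Subtype.val (h t)⟩)
  continuous_toFun := by
    refine isQuotientMap_quot_mk.continuous_iff.2 (continuous_quot_mk.comp ?_)
    refine Continuous.subtype_mk ?_ _
    refine Path.continuous_uncurry_iff.1 ?_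
    exact continuous_subtype_val.comp (by fun_prop :
      Continuous fun z : Dipath A.toDispace x y × I => z.1.1 z.2)

theorem traceIncl_trans {x y z : A.toDispace.carrier} (a : Trace A.toDispace x y)
    (b : Trace A.toDispace y z) :
    A.traceIncl x z (a.trans b) = (A.traceIncl x y a).trans (A.traceIncl y z b) := by
  obtain ⟨p⟩ := a
  obtain ⟨q⟩ := b
  exact congrArg Trace.mk (A.dipathIncl_trans p q)

theorem traceIncl_injective (x y : A.toDispace.carrier) :
    Function.Injective (A.traceIncl x y) := by
  rintro ⟨p⟩ ⟨q⟩ h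
  obtain ⟨r, ⟨φ, hφ, h0, h1, hp⟩, ⟨ψ, hψ, k0, k1, hq⟩⟩ :=
    (Trace.mk_eq_iff (A.dipathIncl p) (A.dipathIncl q)).1 h
  refine (Trace.mk_eq_iff p q).2
    ⟨⟨⟨p.1.toContinuousMap.comp φ, ?_, ?_⟩, A.reparam_mem _ p.2 _ hφ⟩,
      ⟨φ, hφ, h0, h1, fun _ => rfl⟩, ⟨ψ, hψ, k0, k1, fun t => Subtype.ext ?_⟩⟩
  · change p.1 (φ 0) = x
    rw [h0, p.1.source]
  · change p.1 (φ 1) = y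
    rw [h1, p.1.target]
  · exact (hp t).symm.trans (hq t)

/-- The functor induced on trace categories by the inclusion. -/
def traceFunctor : TraceCat A.toDispace ⥤ TraceCat X where
  obj x := ⟨x.pt.1⟩
  map {x y} a := A.traceIncl x.pt y.pt a
  map_id _ := rfl
  map_comp a b := A.traceIncl_trans a b

/-- The restriction to `P(A)` of a natural system on `P(X)`. -/
def restrict {V : Type*} [Category V] (D : NatSys (TraceCat X) V) : NatSys (TraceCat A.toDispace) V :=
  Factn.map A.traceFunctor ⋙ D

/-- The relative trace diagram: it sends a trace `f` of `A` from `x` to `y` to the pair formed by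
the space of traces of `X` and the space of traces of `A` from `x` to `y`, pointed at `f`. -/
def relTraceDiagram : Factn (TraceCat A.toDispace) ⥤ PPair.{u} where
  obj f :=
    { space := Trace X f.src.pt.1 f.tgt.pt.1
      sub := Trace A.toDispace f.src.pt f.tgt.pt
      incl := A.traceIncl _ _
      incl_injective := A.traceIncl_injective _ _
      pt := f.arr }
  map {f f'} a :=
    { onSpace := ((traceDiagram X).map ((Factn.map A.traceFunctor).map a)).map
      onSub := ((traceDiagram A.toDispace).map a).map
      w := fun b => ((A.traceIncl_trans _ _).trans (congrArg _ (A.traceIncl_trans _ _))).symm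
      map_pt := a.w }
  map_id f := by
    apply PPair.Hom.ext
    · exact congrArg PTop.Hom.map ((Factn.map A.traceFunctor ⋙ traceDiagram X).map_id f)
    · exact congrArg PTop.Hom.map ((traceDiagram A.toDispace).map_id f)
  map_comp a b := by
    apply PPair.Hom.ext
    · exact congrArg PTop.Hom.map ((Factn.map A.traceFunctor ⋙ traceDiagram X).map_comp a b)
    · exact congrArg PTop.Hom.map ((traceDiagram A.toDispace).map_comp a b)

/-- The `n`-th natural system of relative directed homotopy of `(X, A)`: the `(n-1)`-st relative
homotopy of the relative trace diagram for `n ≥ 1`. The value for `n = 0` is a convention that is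
not used. -/
def relNatHomotopy : ℕ → NatSys (TraceCat A.toDispace) Act.{u}
  | 0 => (Functor.const _).obj Act.zero
  | n + 1 => A.relTraceDiagram ⋙ relPiAct n

/-- The morphism `P_{n+1}(A) → P_{n+1}(X)` induced by the inclusion. -/
def natIncl (n : ℕ) :
    natHomotopy A.toDispace (n + 1) ⟶ A.restrict (natHomotopy X (n + 1)) :=
  Functor.whiskerLeft A.relTraceDiagram (inclAct n)

/-- The morphism `P_{n+1}(X) → P_{n+1}(X, A)`. -/
def natRel (n : ℕ) : A.restrict (natHomotopy X (n + 1)) ⟶ A.relNatHomotopy (n + 1) :=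
  Functor.whiskerLeft A.relTraceDiagram (relAct n)

/-- The morphism `P_{n+2}(X, A) → P_{n+1}(A)`. -/
def natBdry (n : ℕ) : A.relNatHomotopy (n + 2) ⟶ natHomotopy A.toDispace (n + 1) :=
  Functor.whiskerLeft A.relTraceDiagram (bdryAct n)

/-- The morphism `P_1(X, A) → 0`. -/
def natToZero : A.relNatHomotopy 1 ⟶ (Functor.const _).obj Act.zero where
  app _ := Act.toZero _
  naturality _ _ _ := rfl

end DirectedSubspace
end

end Dihom

/-! Exactness of natural systems is tested at each trace `f` of the subspace. There all terms and
morphisms come from one pointed pair, namely the traces of `A` mapped into the traces of `X` with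
the same end points. The theorem is thus the long exact homotopy sequence of a pair `(S, B)`, with
one precaution: `B` has its own topology, so whatever happens on the distinguished face must be
built as a continuous map into `B`, not merely as a map into `S` with values in `B`.

Write a point of the cube as `(t, x)` and call the last coordinate `x` the height. Four
constructions carry the proof.

If height is read as time, a relative loop with face `q` is a null-homotopy of `q` in `S`, and
conversely (`RelLoop.face_homotopic_const`, `RelLoop.exists_face_eq`). This is exactness at `B`.

A loop of `B` becomes trivial as a relative loop when the cube is pushed up onto its top face: the
bottom face then sweeps out the loop inside `B` (`RelLoop.ofGenLoop_incl_homotopic_const`).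
Conversely, let `H` contract a loop `c` of `S` through relative loops. For fixed `t` it is a map on
the square of times and heights, constant on the sides time 1 and height 1. Rotating a segment about
the origin from the side time 0, where `H` is `c`, to the side height 0, where `H` lies in `B`,
deforms `c` into a loop of `B` (`RelLoop.exists_homotopic_incl`). This is exactness at `S`.

If the face of a relative loop contracts in `B`, the contraction is glued below the cube as a
collar. Stretching the cube over the collar makes the whole boundary constant
(`RelLoop.exists_homotopic_ofGenLoop`). This is exactness at the relative term.

In `Act`, exactness compares two kernels, and `Act.exact_of_exists` reduces it to lifting points. In
low degree, a zero-dimensional loop up to homotopy is a path component, and `RelPi.act_const`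
identifies the orbit map of the base point with the usual map from the loops of `S` to relative
loops. -/

namespace Dihom

/-! ### Criteria for exactness in the category of actions -/

namespace Act

variable {X Y Z : Act.{u}}

/-- Exactness only has to be checked on the underlying pointed sets. -/
theorem exact_of_forall {f : X ⟶ Y} {g : Y ⟶ Z} (hnull : IsNull (f ≫ g))
    (hker : ∀ y, g.onPts y = Z.base → (cokerπ f).onPts y = (coker f).base) : Exact f g := by
  have hset : kerSet (cokerπ f) = kerSet g := by
    refine subset_antisymm (fun y hy => ?_) hker
    -- By the universal property `g` factors through the cokernel of `f`, hence kills whatever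
    -- `cokerπ f` kills.
    obtain ⟨g', rfl, -⟩ := (coker_universal f).2 g hnull
    change g'.onPts ((cokerπ f).onPts y) = Z.base
    rw [show (cokerπ f).onPts y = (coker f).base from hy, g'.map_base]
  refine ⟨hset, ?_⟩
  ext h
  -- The group of a kernel is determined by its set: `k` sends the translate of the base point by
  -- `h` to the translate of the base point by the image of `h`. Equal kernel sets therefore force
  -- equal kernel groups.
  have key : ∀ {W : Act.{u}} (k : Y ⟶ W), h ∈ kerGrp k ↔ Y.act Y.base h ∈ kerSet k := by
    intro W k
    change W.act W.base (k.onGrp h) = W.base ↔ k.onPts (Y.act Y.base h) = W.base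
    rw [k.map_act, k.map_base]
  rw [key, key, hset]

/-- The projection onto the cokernel sends the image to the base point. -/
theorem cokerπ_onPts_apply (f : X ⟶ Y) (x : X.pts) :
    (cokerπ f).onPts (f.onPts x) = (coker f).base :=
  (coker_universal f).1 x

/-- The image of `f` always collapses in the cokernel, so exactness in the classical sense of
pointed sets is enough. It is only a sufficient condition: the kernel of the cokernel may exceed the
image, since the congruence is stable under the group. -/
theorem exact_of_exists {f : X ⟶ Y} {g : Y ⟶ Z} (hnull : IsNull (f ≫ g))
    (hker : ∀ y, g.onPts y = Z.base → ∃ x, f.onPts x = y) : Exact f g :=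
  exact_of_forall hnull fun y hy => by
    obtain ⟨x, rfl⟩ := hker y hy
    exact cokerπ_onPts_apply f x

theorem exact_cokerπ (f : X ⟶ Y) : Exact f (cokerπ f) := ⟨rfl, rfl⟩

theorem exact_toZero {f : X ⟶ Y} (hf : Function.Surjective f.onPts) : Exact f (toZero Y) :=
  exact_of_exists (fun _ => rfl) fun y _ => hf y

end Act

/-! ### Equality of homotopy classes -/

/-- A zero-dimensional loop is determined up to homotopy by the path component of its value. -/
theorem genLoop_zero_homotopic_iff {S : Type*} [TopologicalSpace S] {s : S}
    {p q : Ω^ (Fin 0) S s} :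
    GenLoop.Homotopic p q ↔ ZerothHomotopy.mk (p 0) = ZerothHomotopy.mk (q 0) := by
  constructor
  · rintro ⟨H⟩
    exact ZerothHomotopy.sound
      ⟨⟨fun r => H (r, 0), by fun_prop⟩, H.apply_zero _, H.apply_one _⟩
  · intro h
    obtain ⟨γ⟩ : Joined _ _ := Quotient.exact h
    -- The cube `Fin 0 → I` is a single point with empty boundary, so a path is already a homotopy
    -- and the condition on the boundary is vacuous.
    refine ⟨⟨⟨⟨fun z => γ z.1, by fun_prop⟩, fun t => ?_, fun t => ?_⟩,
      fun _ _ ⟨i, _⟩ => i.elim0⟩⟩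
    · rw [Subsingleton.elim t 0]; exact γ.source
    · rw [Subsingleton.elim t 0]; exact γ.target

theorem PiGrp.mk_eq_mk {n : ℕ} {S : Type u} [TopologicalSpace S] {s : S}
    {p q : Ω^ (Fin (n + 1)) S s} : PiGrp.mk p = PiGrp.mk q ↔ GenLoop.Homotopic p q :=
  ⟨fun h => Quotient.exact (MulOpposite.op_injective h), PiGrp.sound⟩

theorem RelPi.mk_eq_mk {P : PPair.{u}} {n : ℕ} {p q : RelLoop P n} :
    RelPi.mk p = RelPi.mk q ↔ RelLoop.Homotopic p q :=
  ⟨fun h => Quotient.exact h, RelPi.sound⟩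

/-! ### Deformations of cubes -/

namespace RelLoop

variable {P : PPair.{u}} {n : ℕ}

@[fun_prop]
theorem continuous_cubeSnoc_comp {Y : Type*} [TopologicalSpace Y] {f : Y → Fin n → I} {g : Y → I}
    (hf : Continuous f) (hg : Continuous g) : Continuous fun y => cubeSnoc (f y) (g y) :=
  continuous_cubeSnoc.comp (hf.prodMk hg)

/-- The distinguished face is null-homotopic in the ambient space. -/
theorem face_homotopic_const (p : RelLoop P n) :
    GenLoop.Homotopic (genLoopMap P.incl rfl p.face) GenLoop.const := by
  -- The height serves as time: at height 0 one sees the face, at height 1 and over the boundary of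
  -- the face one is in `cubeJ n`.
  refine ⟨⟨⟨⟨fun z => p.toMap (cubeSnoc z.2 z.1),
    by fun_prop⟩, p.toMap_face,
    fun t => p.toMap_J _ (Or.inl (Fin.snoc_last _ _))⟩, fun s t ht => ?_⟩⟩
  exact (p.toMap_J _ (cubeSnoc_mem_J ht s)).trans (congrArg P.incl (p.face.2 t ht)).symm

/-- A null-homotopy in the ambient space is a map of triples. -/
theorem exists_face_eq {q : Ω^ (Fin n) P.sub P.pt}
    (h : GenLoop.Homotopic (genLoopMap P.incl rfl q) GenLoop.const) :
    ∃ p : RelLoop P n, p.face = q := by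
  obtain ⟨H⟩ := h
  refine ⟨{
    -- Conversely, the time of the null-homotopy becomes the height.
    toMap := ⟨fun y => H (y (Fin.last n), fun i => y i.castSucc), by fun_prop⟩
    face := q
    toMap_face := fun t => ?_
    toMap_J := ?_ }, rfl⟩
  · change H (cubeSnoc t 0 (Fin.last n), fun i => cubeSnoc t 0 i.castSucc) = _
    simp only [cubeSnoc, Fin.snoc_last, Fin.snoc_castSucc]
    exact H.apply_zero t
  · rintro y (hy | hy)
    · change H (y (Fin.last n), _) = _
      rw [hy]
      exact H.apply_one _
    · exact (H.eq_fst _ hy).trans (congrArg P.incl (q.2 _ hy))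

theorem cubeSnoc_mem_boundary {t : Fin n → I} (ht : t ∈ Cube.boundary (Fin n)) (s : I) :
    cubeSnoc t s ∈ Cube.boundary (Fin (n + 1)) := by
  obtain ⟨i, hi⟩ := ht
  exact ⟨i.castSucc, by simpa only [cubeSnoc, Fin.snoc_castSucc] using hi⟩

theorem cubeSnoc_mem_boundary_of_last (t : Fin n → I) {s : I} (hs : s = 0 ∨ s = 1) :
    cubeSnoc t s ∈ Cube.boundary (Fin (n + 1)) :=
  ⟨Fin.last n, by simpa only [cubeSnoc, Fin.snoc_last] using hs⟩

/-- A loop in the subspace is trivial as a map of triples. -/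
theorem ofGenLoop_incl_homotopic_const (d : Ω^ (Fin (n + 1)) P.sub P.pt) :
    Homotopic (ofGenLoop (genLoopMap P.incl rfl d)) (const : RelLoop P n) := by
  -- At time `s` heights below `s` are raised to `s`. The bottom face is then the slice of `d` at
  -- height `s`, which is continuous into the subspace because `d` is. At time 1 every point has
  -- reached the top face, where `d` is constant.
  refine ⟨fun s =>
    { toMap := ⟨fun y => P.incl (d.1 (cubeSnoc (fun i : Fin n => y i.castSucc)
        (y (Fin.last n) ⊔ s))), ?_⟩
      face := ⟨⟨fun t => d.1 (cubeSnoc t s), ?_⟩, fun t ht => d.2 _ (cubeSnoc_mem_boundary ht s)⟩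
      toMap_face := fun t => ?_
      toMap_J := ?_ }, ?_, ?_, ?_, ?_⟩
  · fun_prop
  · fun_prop
  · change P.incl (d.1 (cubeSnoc (fun i : Fin n => cubeSnoc t 0 i.castSucc)
      (cubeSnoc t 0 (Fin.last n) ⊔ s))) = P.incl (d.1 (cubeSnoc t s))
    simp only [cubeSnoc, Fin.snoc_last, Fin.snoc_castSucc]
    rw [sup_of_le_right (show (0 : I) ≤ s from s.2.1)]
  · rintro y (hy | hy)
    · refine congrArg P.incl (d.2 _ (cubeSnoc_mem_boundary_of_last _ (Or.inr ?_)))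
      rw [hy, sup_of_le_left (show s ≤ (1 : I) from s.2.2)]
    · exact congrArg P.incl (d.2 _ (cubeSnoc_mem_boundary hy _))
  · change Continuous fun z : I × (Fin (n + 1) → I) =>
      P.incl (d.1 (cubeSnoc (fun i : Fin n => z.2 i.castSucc) (z.2 (Fin.last n) ⊔ z.1)))
    fun_prop
  · change Continuous fun z : I × (Fin n → I) => d.1 (cubeSnoc z.2 z.1)
    fun_prop
  · apply RelLoop.ext
    · ext y
      change P.incl (d.1 (cubeSnoc _ (y (Fin.last n) ⊔ 0))) = P.incl (d.1 y)
      rw [sup_of_le_left (show (0 : I) ≤ y (Fin.last n) from (y (Fin.last n)).2.1), cubeSnoc_init]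
    · apply GenLoop.ext
      intro t
      exact d.2 _ (cubeSnoc_mem_boundary_of_last t (Or.inl rfl))
  · apply RelLoop.ext
    · ext y
      refine congrArg P.incl (d.2 _ (cubeSnoc_mem_boundary_of_last _ (Or.inr ?_)))
      exact sup_of_le_right (show y (Fin.last n) ≤ (1 : I) from (y (Fin.last n)).2.2)
    · apply GenLoop.ext
      intro t
      exact d.2 _ (cubeSnoc_mem_boundary_of_last t (Or.inr rfl))

/-- A loop that is trivial as a map of triples is homotopic to a loop in the subspace: the trace of
the homotopy on the distinguished face. -/
theorem exists_homotopic_incl {c : Ω^ (Fin (n + 1)) P.space (P.incl P.pt)}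
    (h : Homotopic (ofGenLoop c) (const : RelLoop P n)) :
    ∃ d : Ω^ (Fin (n + 1)) P.sub P.pt, GenLoop.Homotopic c (genLoopMap P.incl rfl d) := by
  obtain ⟨H, h1, h2, H0, H1⟩ := h
  have last_zero : ∀ y : Fin (n + 1) → I, y (Fin.last n) = 0 →
      (H 0).toMap y = P.incl P.pt := by
    intro y hy
    rw [H0]
    exact c.2 y ⟨_, Or.inl hy⟩
  have toMap_one : ∀ y, (H 1).toMap y = P.incl P.pt := fun y => by rw [H1]; rfl
  -- The height of `d` is the time of `H`. At both ends of time the face is constant, as `H` runs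
  -- from a loop constant on its whole boundary to the constant map.
  let d : Ω^ (Fin (n + 1)) P.sub P.pt :=
    ⟨⟨fun y => (H (y (Fin.last n))).face (fun i => y i.castSucc),
      h2.comp (by fun_prop : Continuous fun y : Fin (n + 1) → I =>
        (y (Fin.last n), fun i : Fin n => y i.castSucc))⟩, by
      rintro y ⟨i, hi⟩
      change (H (y (Fin.last n))).face (fun i => y i.castSucc) = P.pt
      induction i using Fin.lastCases with
      | last =>
        rcases hi with hi | hi
        · rw [hi, H0]; rfl
        · rw [hi, H1]; rfl
      | cast i => exact (H _).face.2 _ ⟨i, hi⟩⟩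
  -- the coordinates of the segment from the origin to the point of the broken line from
  -- `(1, 0)` through `(1, 1)` to `(0, 1)` with parameter `u`
  let a : I → I := fun u => Set.projIcc 0 1 zero_le_one (2 * (u : ℝ))
  let b : I → I := fun u => Set.projIcc 0 1 zero_le_one (2 * (1 - (u : ℝ)))
  have ca : Continuous a := by fun_prop
  have cb : Continuous b := by fun_prop
  have a0 : a 0 = 0 := Set.projIcc_of_le_left _ (by simp)
  have a1 : a 1 = 1 := Set.projIcc_of_right_le _ (by simp)
  have b0 : b 0 = 1 := Set.projIcc_of_right_le _ (by simp)
  have b1 : b 1 = 0 := Set.projIcc_of_le_left _ (by simp)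
  -- The moving end of the segment always has time 1 or height 1, and `H` is at the base point on
  -- both sides.
  have ab : ∀ u, a u = 1 ∨ b u = 1 := fun u => by
    rcases le_total (1 / 2 : ℝ) u with hu | hu
    · exact Or.inl (Set.projIcc_of_right_le _ (by linarith))
    · exact Or.inr (Set.projIcc_of_right_le _ (by linarith))
  -- At parameter `u` the height `x` is replaced by the point of the square with time `a u * x` and
  -- height `b u * x`. For `u = 0` the time stays 0 and the result is `c`; for `u = 1` the height
  -- stays 0 and the result is `d`.
  refine ⟨d, ⟨⟨⟨⟨fun z => (H (a z.1 * z.2 (Fin.last n))).toMap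
    (cubeSnoc (fun i : Fin n => z.2 i.castSucc) (b z.1 * z.2 (Fin.last n))), ?_⟩, ?_, ?_⟩, ?_⟩⟩⟩
  · exact h1.comp (by fun_prop : Continuous fun z : I × (Fin (n + 1) → I) =>
      (a z.1 * z.2 (Fin.last n),
        cubeSnoc (fun i : Fin n => z.2 i.castSucc) (b z.1 * z.2 (Fin.last n))))
  · intro y
    change (H (a 0 * _)).toMap (cubeSnoc _ (b 0 * _)) = c y
    rw [a0, b0, zero_mul, one_mul, H0, cubeSnoc_init]
    rfl
  · intro y
    change (H (a 1 * _)).toMap (cubeSnoc _ (b 1 * _)) = P.incl (d y)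
    rw [a1, b1, zero_mul, one_mul, toMap_face]
    rfl
  · rintro u y ⟨i, hi⟩
    rw [show c.1 y = P.incl P.pt from c.2 y ⟨i, hi⟩]
    change (H (a u * y (Fin.last n))).toMap (cubeSnoc _ (b u * y (Fin.last n))) = _
    induction i using Fin.lastCases with
    | last =>
      rcases hi with hi | hi
      -- All segments start at time 0 and height 0, a boundary point of `c`.
      · rw [hi, mul_zero, mul_zero]
        exact last_zero _ (Fin.snoc_last _ _)
      · rw [hi, mul_one, mul_one]
        rcases ab u with hu | hu
        · rw [hu, toMap_one]
        · rw [hu]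
          exact (H _).toMap_J _ (Or.inl (Fin.snoc_last _ _))
    | cast i => exact (H _).toMap_J _ (cubeSnoc_mem_J ⟨i, hi⟩ _)

/-- A map of triples whose face is null-homotopic in the subspace is homotopic to one that is
constant on the whole boundary. -/
theorem exists_homotopic_ofGenLoop {p : RelLoop P n}
    (h : GenLoop.Homotopic p.face GenLoop.const) :
    ∃ c : Ω^ (Fin (n + 1)) P.space (P.incl P.pt), Homotopic p (ofGenLoop c) := by
  obtain ⟨D⟩ := h
  -- `p` extended by `D` to the coordinates in `[-1, 0]`
  let E : (Fin n → I) × ℝ → P.space := fun z =>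
    if 0 ≤ z.2 then p.toMap (cubeSnoc z.1 (Set.projIcc 0 1 zero_le_one z.2))
    else P.incl (D (Set.projIcc 0 1 zero_le_one (-z.2), z.1))
  have cE : Continuous E := by
    -- The two pieces agree at level 0 because `D` starts at the face of `p`.
    refine Continuous.if_le ?_ ?_ continuous_const continuous_snd ?_
    · fun_prop
    · fun_prop
    · rintro ⟨t, r⟩ hr
      have hr : 0 = r := hr
      subst hr
      change p.toMap (cubeSnoc t _) = P.incl (D (Set.projIcc 0 1 zero_le_one (-0), t))
      rw [neg_zero, Set.projIcc_left]
      exact (p.toMap_face t).trans (congrArg P.incl (D.apply_zero t)).symm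
  have E_nonneg : ∀ t (r : I), E (t, r) = p.toMap (cubeSnoc t r) := fun t r => by
    simp only [E, if_pos r.2.1, Set.projIcc_val]
  have E_neg : ∀ t (s : I), E (t, -(s : ℝ)) = P.incl (D (s, t)) := by
    intro t s
    -- Level 0 belongs to the branch of `p` in the definition of `E`, so `s = 0` needs the matching
    -- of the two pieces.
    rcases s.2.1.eq_or_lt with hs | hs
    · obtain rfl : s = 0 := Subtype.ext hs.symm
      rw [show (-((0 : I) : ℝ)) = ((0 : I) : ℝ) by simp, E_nonneg]
      exact (p.toMap_face t).trans (congrArg P.incl (D.apply_zero t)).symm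
    · simp only [E, if_neg (not_le.2 (neg_lt_zero.2 hs)), neg_neg, Set.projIcc_val]
  have D_boundary : ∀ s, ∀ t ∈ Cube.boundary (Fin n), D (s, t) = P.pt := fun s t ht =>
    (D.eq_fst s ht).trans (p.face.2 t ht)
  have E_boundary : ∀ t ∈ Cube.boundary (Fin n), ∀ r, E (t, r) = P.incl P.pt := by
    intro t ht r
    simp only [E]
    split_ifs
    · exact p.toMap_J _ (cubeSnoc_mem_J ht _)
    · exact congrArg P.incl (D_boundary _ t ht)
  have E_one : ∀ t, E (t, 1) = P.incl P.pt := fun t =>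
    (E_nonneg t 1).trans (p.toMap_J _ (Or.inl (Fin.snoc_last _ _)))
  -- The heights are stretched affinely from `[0, 1]` onto `[-s, 1]`. The top stays at level 1, and
  -- the bottom lies at level `-s`, where `E` is `D` at time `s`; hence the face stays in the
  -- subspace.
  let F : I → RelLoop P n := fun s =>
    { toMap := ⟨fun y => E (fun i => y i.castSucc, (1 + (s : ℝ)) * y (Fin.last n) - s),
        cE.comp (by fun_prop)⟩
      face := ⟨⟨fun t => D (s, t), by fun_prop⟩, D_boundary s⟩
      toMap_face := fun t => by
        change E (fun i => cubeSnoc t 0 i.castSucc,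
          (1 + (s : ℝ)) * (cubeSnoc t 0 (Fin.last n) : I) - s) = P.incl (D (s, t))
        simp only [cubeSnoc, Fin.snoc_last, Fin.snoc_castSucc]
        rw [← E_neg]
        simp
      toMap_J := by
        rintro y (hy | hy)
        · change E (_, (1 + (s : ℝ)) * y (Fin.last n) - s) = _
          rw [hy, ← E_one fun i => y i.castSucc]
          simp
        · exact E_boundary _ hy _ }
  have F_one_face : (F 1).face = GenLoop.const := GenLoop.ext _ _ fun t => D.apply_one t
  -- At `s = 1` the bottom is the end of `D`, so it is constant like the rest of the boundary and `F
  -- 1` comes from a loop of the ambient space.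
  refine ⟨⟨(F 1).toMap, ?_⟩, F, ?_, ?_, ?_, ?_⟩
  · rintro y ⟨i, hi⟩
    induction i using Fin.lastCases with
    | last =>
      rcases hi with hi | hi
      · rw [← cubeSnoc_init y, hi]
        refine ((F 1).toMap_face _).trans ?_
        rw [F_one_face]
        rfl
      · exact (F 1).toMap_J y (Or.inl hi)
    | cast i => exact (F 1).toMap_J y (Or.inr ⟨i, hi⟩)
  · exact cE.comp (by fun_prop)
  · exact D.continuous
  · apply RelLoop.ext
    · ext y
      change E (_, (1 + ((0 : I) : ℝ)) * y (Fin.last n) - ((0 : I) : ℝ)) = p.toMap y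
      rw [Set.Icc.coe_zero, add_zero, one_mul, sub_zero, E_nonneg, cubeSnoc_init]
    · exact GenLoop.ext _ _ fun t => D.apply_zero t
  · exact RelLoop.ext rfl F_one_face

end RelLoop

/-! ### The deformations on homotopy classes -/

namespace RelPi

variable (P : PPair.{u})

/-- The translate of the base point by a loop is the class of that loop. -/
theorem act_const (c : PiGrp 0 P.space (P.incl P.pt)) :
    act (mk RelLoop.const) c = ofPi P 0 c := by
  induction c using PiGrp.ind with
  | h c =>
  rw [act_mk]
  -- As a path, the translate is the constant path followed by `c`, which contracts to `c` with the
  -- end points fixed.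
  refine (sound (RelLoop.ofPath_homotopic (b := P.pt)
    (γ' := genLoopEquivOfUnique (Fin 1) c) ⟨Path.Homotopy.reflTrans _⟩)).trans
      (congrArg mk (RelLoop.ext ?_ ?_))
  · ext y
    change c (fun _ => y 0) = c y
    refine congrArg c (funext fun i => ?_)
    rw [Fin.eq_zero i]
  · rfl

variable (n : ℕ)

/-- The easy half of exactness at the ambient space. The class of the constant map is the base point
when `n = 0` and the unit otherwise, so one statement serves all degrees. -/
theorem ofPi_map_incl (d : PiGrp n P.sub P.pt) :
    ofPi P n (PiGrp.map n P.incl rfl d) = mk RelLoop.const := by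
  induction d using PiGrp.ind with
  | h d => exact sound (RelLoop.ofGenLoop_incl_homotopic_const d)

/-- The lifting half of exactness at the ambient space: the preimage is the track of the
distinguished face during a contraction of `c` through maps of triples. -/
theorem exists_map_incl_eq {c : PiGrp n P.space (P.incl P.pt)}
    (h : ofPi P n c = mk RelLoop.const) : ∃ d, PiGrp.map n P.incl rfl d = c := by
  induction c using PiGrp.ind with
  | h c =>
  obtain ⟨d, hd⟩ := RelLoop.exists_homotopic_incl (mk_eq_mk.1 h)
  exact ⟨PiGrp.mk d, (PiGrp.sound hd).symm⟩

/-- The lifting half of exactness at the relative homotopy. A hypothesis on the face itself covers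
both path components (`n = 0`) and homotopy groups (`n > 0`). -/
theorem exists_ofPi_eq {p : RelLoop P n} (h : GenLoop.Homotopic p.face GenLoop.const) :
    ∃ c, ofPi P n c = mk p := by
  obtain ⟨c, hc⟩ := RelLoop.exists_homotopic_ofGenLoop h
  exact ⟨PiGrp.mk c, (sound hc).symm⟩

end RelPi

/-! ### The exact sequence of a pointed pair -/

section PairSequence

variable (P : PPair.{u})

/-- Exactness of the homotopy sequence of a pair at the homotopy of the subspace. -/
theorem exact_bdryAct_inclAct : ∀ n : ℕ, Act.Exact ((bdryAct n).app P) ((inclAct n).app P)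
  | 0 => by
    refine Act.exact_of_exists ?_ ?_
    · refine RelPi.ind fun p => ?_
      exact genLoop_zero_homotopic_iff.1 p.face_homotopic_const
    · rintro ⟨b⟩ hb
      -- Any point is a zero-dimensional loop, since there is no boundary to send to the base point.
      let q : Ω^ (Fin 0) P.sub P.pt := ⟨ContinuousMap.const _ b, fun _ ⟨i, _⟩ => i.elim0⟩
      obtain ⟨p, hp⟩ := RelLoop.exists_face_eq (q := q) (genLoop_zero_homotopic_iff.2 hb)
      refine ⟨RelPi.mk p, ?_⟩
      change ZerothHomotopy.mk (p.face 0) = _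
      rw [hp]
      rfl
  | n + 1 => by
    refine Act.exact_of_exists ?_ ?_
    · refine RelPi.ind fun p => ?_
      exact PiGrp.sound p.face_homotopic_const
    · refine PiGrp.ind fun q hq => ?_
      obtain ⟨p, rfl⟩ := RelLoop.exists_face_eq (PiGrp.mk_eq_mk.1 hq)
      exact ⟨RelPi.mk p, rfl⟩

/-- Exactness of the homotopy sequence of a pair at the homotopy of the ambient space. -/
theorem exact_inclAct_relAct : ∀ n : ℕ, Act.Exact ((inclAct n).app P) ((relAct n).app P)
  | 0 => Act.exact_cokerπ _
  -- Here the map on points is the orbit map of the base point, which `RelPi.act_const` turns into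
  -- `RelPi.ofPi`.
  | 1 => Act.exact_of_exists
      (fun d => (RelPi.act_const P _).trans (RelPi.ofPi_map_incl P 0 d))
      (fun c hc => RelPi.exists_map_incl_eq P 0 ((RelPi.act_const P c).symm.trans hc))
  | n + 2 => Act.exact_of_exists
      (fun d => (RelPi.ofPi_map_incl P (n + 1) d).trans RelPi.one_def.symm)
      (fun _ hc => RelPi.exists_map_incl_eq P (n + 1) (Eq.trans hc RelPi.one_def))

/-- Exactness of the homotopy sequence of a pair at the relative homotopy. -/
theorem exact_relAct_bdryAct : ∀ n : ℕ, Act.Exact ((relAct (n + 1)).app P) ((bdryAct n).app P)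
  | 0 => by
    -- Concatenation on the right does not move the source of a path, so translates of the constant
    -- path start at the base point.
    refine Act.exact_of_exists (PiGrp.ind fun _ => rfl) (RelPi.ind fun p hp => ?_)
    obtain ⟨c, hc⟩ := RelPi.exists_ofPi_eq P 0 (p := p) (genLoop_zero_homotopic_iff.2 hp)
    exact ⟨c, (RelPi.act_const P c).trans hc⟩
  | n + 1 => by
    refine Act.exact_of_exists (PiGrp.ind fun _ => rfl) (RelPi.ind fun p hp => ?_)
    exact RelPi.exists_ofPi_eq P (n + 1) (PiGrp.mk_eq_mk.1 hp)

/-- Exactness of the homotopy sequence of a pair at its last term. -/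
theorem exact_relAct_toZero : Act.Exact ((relAct 0).app P) (Act.toZero _) :=
  Act.exact_toZero Quot.mk_surjective

end PairSequence

end Dihom

/-! ### The exact sequence of natural systems -/

theorem mainTheorem3 (X : Dihom.Dispace.{u}) (A : Dihom.DirectedSubspace X) :
    (∀ n : ℕ,
      -- exactness at `P_{n+1}(A)`
      Dihom.NatExact (A.natBdry n) (A.natIncl n) ∧
      -- exactness at `P_{n+1}(X)`
      Dihom.NatExact (A.natIncl n) (A.natRel n) ∧
      -- exactness at `P_{n+2}(X, A)`; for `n = 0` this is the action `(P_2(X, A), P_2(X))`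
      Dihom.NatExact (A.natRel (n + 1)) (A.natBdry n)) ∧
    -- exactness at `P_1(X, A)`
    Dihom.NatExact (A.natRel 0) A.natToZero :=
  -- The morphisms are whiskerings with `A.relTraceDiagram`, so their components at `f` are those of
  -- the sequence of the pair at `f`.
  ⟨fun n => ⟨fun f => Dihom.exact_bdryAct_inclAct (A.relTraceDiagram.obj f) n,
    fun f => Dihom.exact_inclAct_relAct (A.relTraceDiagram.obj f) n,
    fun f => Dihom.exact_relAct_bdryAct (A.relTraceDiagram.obj f) n⟩,
    fun f => Dihom.exact_relAct_toZero (A.relTraceDiagram.obj f)⟩
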